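/- Let $M$ be a compact smooth manifold of dimension $n\ge 1$ and let $\mathcal F\colon TM\to[0,\infty)$ be a Finsler norm on $M$: a continuous function, positively $1$-homogeneous on each tangent space, smooth on $TM\setminus\{0\}$, such that for all $x\in M$ and $0\neq y\in T_xM$ the form $g_{x,y}(u,v)=\frac12\frac{\partial^2}{\partial s\,\partial t}\mathcal F^2(x,y+su+tv)\big|_{s=t=0}$ is positive definite. Write $\mathcal I_pM=\{y\in T_pM:\mathcal F(p,y)=1\}$ for the indicatrix at $p$ and $\mathcal IM=\{v\in TM:\mathcal F(v)=1\}$ for the indicatrix bundle, an embedded submanifold of $TM$. In the local coordinates $(x^i,y^i)$ of $TM$ induced by a chart of $M$, let $G^i=\frac14 g^{il}\bigl(2\frac{\partial g_{jl}}{\partial x^k}-\frac{\partial g_{jk}}{\partial x^l}\bigr)y^jy^k$ and $G^i_j=\partial G^i/\partial y^j$. A vector field $X(t)$ along a piecewise $C^1$ curve $c\colon[0,1]\to M$ is parallel if $\dot X^i+G^i_j(c,X)\,\dot c^j=0$; parallel translation along $c$ sends $X(0)$ to $X(1)$ and preserves $\mathcal F$. The holonomy group $\mathrm{Hol}_p(M)$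 is the group of transformations of $\mathcal I_pM$ generated by the parallel translations along piecewise $C^1$ closed curves starting at $p$. The fibered holonomy group $\mathrm{Hol}_{f}(M)\subset\mathrm{Diff}^\infty(\mathcal IM)$ is the group generated by the fiber preserving diffeomorphisms $\Phi$ of $\mathcal IM$ such that $\Phi|_{\mathcal I_pM}\in\mathrm{Hol}_p(M)$ for every $p\in M$. A smooth vector field $\xi$ on $\mathcal IM$ is tangent to a subgroup $G\subset\mathrm{Diff}^\infty(\mathcal IM)$ if there are an integer $k\ge1$, an open interval $I\ni 0$ and a smooth curve $\varphi\colon I\to\mathrm{Diff}^\infty(\mathcal IM)$ (that is, $(t,v)\mapsto\varphi_t(v)$ is smooth) with $\varphi_t\in G$ for all $t\in I$ and $\varphi_0=\mathrm{id}$, such that for every $v\in\mathcal IM$ the derivatives of $t\mapsto\varphi_t(v)$ at $t=0$ of orders $1,\dots,k-1$ vanish and the $k$-th derivative is $\xi(v)$. The fibered holonomy algebra $\mathfrak{hol}_f(M)$ is the set of all smooth vector fields on $\mathcal IM$ tangent to $\mathrm{Hol}_f(M)$. Theorem. The fibered holonomy algebra $\mathfrak{hol}_f(M)$ is a Lie subalgebra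 of the real Lie algebra $\mathfrak X(\mathcal IM)$ of smooth vector fields on $\mathcal IM$. -/

import Mathlib

open Set Bundle
open scoped Manifold ContDiff Topology

theorem contDiffOn_of_contMDiffOn_model {E : Type*} [NormedAddCommGroup E] [NormedSpace ℝ E]
    {H : Type*} [TopologicalSpace H] (I : ModelWithCorners ℝ E H) {f : H → H} {s : Set H}
    (hf : ContMDiffOn I I ∞ f s) :
    ContDiffOn ℝ ∞ (I ∘ f ∘ I.symm) (I.symm ⁻¹' s ∩ range I) := by
  intro y hy
  have h := ((contMDiffOn_iff.1 hf).2 (I.symm y) (I.symm y))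
  simp only [extChartAt, chartAt_self_eq, mfld_simps] at h
  rw [inter_comm]
  exact h y ⟨hy.2, hy.1⟩

/-! ### Diffeomorphism groups, vector fields, tangent vector fields of a subgroup -/

section Diffeomorphisms

variable {E : Type*} [NormedAddCommGroup E] [NormedSpace ℝ E]
  {H : Type*} [TopologicalSpace H] (J : ModelWithCorners ℝ E H)
  (N : Type*) [TopologicalSpace N] [ChartedSpace H N]

/-- The `C^∞` diffeomorphisms of `N` form a group under composition, `(φ * ψ) p = φ (ψ p)`. -/
noncomputable instance Diffeomorph.instGroupSelf : Group (N ≃ₘ^∞⟮J, J⟯ N) where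
  mul φ ψ := ψ.trans φ
  one := Diffeomorph.refl J N ∞
  inv φ := φ.symm
  mul_assoc _ _ _ := rfl
  one_mul _ := rfl
  mul_one _ := rfl
  inv_mul_cancel φ := Diffeomorph.ext fun p => φ.symm_apply_apply p

/-- The curve `c`, defined near `0`, is a `k`-th order integral curve of the tangent vector `w` at
`p = c 0`: its derivatives of order `1, …, k - 1` at `0` vanish and its `k`-th derivative is `w`.
The derivatives are taken in the preferred chart at `p`, the one through which Mathlib identifies
`T_p N` with the model vector space. -/
def IsIntegralCurveOfOrder (k : ℕ) (c : ℝ → N) (p : N) (w : TangentSpace J p) : Prop :=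
  1 ≤ k ∧ c 0 = p ∧
    (∀ j : ℕ, 1 ≤ j → j < k → iteratedDeriv j (fun t => extChartAt J p (c t)) 0 = 0) ∧
    iteratedDeriv k (fun t => extChartAt J p (c t)) 0 = w

/-- The smooth vector fields on `N`. -/
abbrev SmoothVectorField [IsManifold J ∞ N] : Type _ :=
  Cₛ^∞⟮J; E, (TangentSpace J : N → Type _)⟯

variable {J N} [IsManifold J ∞ N]

theorem SmoothVectorField.mdifferentiableAt (X : SmoothVectorField J N) (p : N) :
    MDifferentiableAt J J.tangent (fun x => (⟨x, X x⟩ : TangentBundle J N)) p :=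
  (X.contMDiff p).mdifferentiableAt (by simp)


/-- The Lie algebra structure on the smooth vector fields is given by the Lie bracket of
vector fields on manifolds. -/
noncomputable instance SmoothVectorField.instLieRing [CompleteSpace E] : LieRing (SmoothVectorField J N) where
  bracket X Y := ⟨VectorField.mlieBracket J X Y, by
    have : IsManifold J (minSmoothness ℝ 3) N := by
      rw [minSmoothness_of_isRCLikeNormedField]; infer_instance
    have : IsManifold J ((∞ : ℕ∞ω) + 1) N := inferInstanceAs (IsManifold J ∞ N)
    exact ContDiff.mlieBracket_vectorField (m := ⊤) (n := ⊤) X.contMDiff Y.contMDiff (by simp)⟩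
  add_lie X Y Z := by
    ext1 p
    exact VectorField.mlieBracket_add_left (X.mdifferentiableAt p) (Y.mdifferentiableAt p)
  lie_add X Y Z := by
    ext1 p
    exact VectorField.mlieBracket_add_right (Y.mdifferentiableAt p) (Z.mdifferentiableAt p)
  lie_self X := by
    ext1 p
    exact congrFun (VectorField.mlieBracket_self (I := J) (V := X)) p
  leibniz_lie X Y Z := by
    have : IsManifold J (minSmoothness ℝ 3) N := by
      rw [minSmoothness_of_isRCLikeNormedField]; infer_instance
    have h : minSmoothness ℝ 2 ≤ (∞ : ℕ∞ω) := by
      rw [minSmoothness_of_isRCLikeNormedField]; exact ENat.LEInfty.out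
    ext1 p
    exact VectorField.leibniz_identity_mlieBracket_apply ((X.contMDiff p).of_le h)
      ((Y.contMDiff p).of_le h) ((Z.contMDiff p).of_le h)

noncomputable instance SmoothVectorField.instLieAlgebra [CompleteSpace E] :
    LieAlgebra ℝ (SmoothVectorField J N) where
  lie_smul c X Y := by
    ext1 p
    exact VectorField.mlieBracket_const_smul_right (Y.mdifferentiableAt p)

/-- `X` is tangent to the subgroup `G` of the diffeomorphism group: there is a smooth curve
`t ↦ φ t`, `t ∈ (-ε, ε)`, of diffeomorphisms in `G` with `φ 0 = id` and an order `k` such that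
every `t ↦ φ t p` is a `k`-th order integral curve of `X p`. Smoothness of the curve in the
diffeomorphism group means that `(t, p) ↦ φ t p` is smooth. -/
def IsTangentTo (G : Subgroup (N ≃ₘ^∞⟮J, J⟯ N)) (X : SmoothVectorField J N) : Prop :=
  ∃ (ε : ℝ) (φ : ℝ → N ≃ₘ^∞⟮J, J⟯ N), 0 < ε ∧
    (∀ t ∈ Ioo (-ε) ε, φ t ∈ G) ∧
    ContMDiffOn (𝓘(ℝ, ℝ).prod J) J ∞ (fun q : ℝ × N => φ q.1 q.2) (Ioo (-ε) ε ×ˢ univ) ∧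
    φ 0 = 1 ∧
    ∃ k : ℕ, ∀ p : N, IsIntegralCurveOfOrder J N k (fun t => φ t p) p (X p)

/-- The set of vector fields tangent to `G`. -/
def tangentAlgebra (G : Subgroup (N ≃ₘ^∞⟮J, J⟯ N)) : Set (SmoothVectorField J N) :=
  {X | IsTangentTo G X}

end Diffeomorphisms

/-! ### Finsler manifolds -/

noncomputable section Finsler

/-- A Finsler structure on the manifold `M` of dimension `n + 1`. -/
structure FinslerStructure (n : ℕ) (M : Type*) [TopologicalSpace M]
    [ChartedSpace (EuclideanSpace ℝ (Fin (n + 1))) M] [IsManifold (𝓡 (n + 1)) ∞ M] where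
  /-- the Finsler norm `𝓕 : TM → ℝ` -/
  norm : TangentBundle (𝓡 (n + 1)) M → ℝ
  nonneg : ∀ v, 0 ≤ norm v
  continuous_norm : Continuous norm
  /-- positive homogeneity of degree one on every tangent space -/
  homogeneous : ∀ (x : M) (y : TangentSpace (𝓡 (n + 1)) x) (a : ℝ), 0 < a →
    norm ⟨x, a • y⟩ = a * norm ⟨x, y⟩
  /-- smoothness on the slit tangent manifold -/
  smooth : ContMDiffOn (𝓡 (n + 1)).tangent 𝓘(ℝ, ℝ) ∞ norm {v | v.2 ≠ 0}
  /-- the form `g_{x,y}(u, w) = ½ ∂²/∂s∂t 𝓕²(y + s u + t w)` at `s = t = 0` is positive definite -/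
  posDef : ∀ (x : M) (y u : TangentSpace (𝓡 (n + 1)) x), y ≠ 0 → u ≠ 0 →
    0 < (1 / 2 : ℝ) * deriv (fun s : ℝ => deriv (fun t : ℝ =>
      norm ⟨x, y + s • u + t • u⟩ ^ 2) 0) 0

variable {n : ℕ} {M : Type*} [TopologicalSpace M]
  [ChartedSpace (EuclideanSpace ℝ (Fin (n + 1))) M] [IsManifold (𝓡 (n + 1)) ∞ M]

namespace FinslerStructure

theorem norm_zero (F : FinslerStructure n M) (x : M) :
    F.norm ⟨x, (0 : TangentSpace (𝓡 (n + 1)) x)⟩ = 0 := by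
  have h := F.homogeneous x 0 2 (by norm_num)
  rw [smul_zero] at h
  linarith

theorem norm_pos (F : FinslerStructure n M) {x : M} {y : TangentSpace (𝓡 (n + 1)) x}
    (hy : y ≠ 0) : 0 < F.norm ⟨x, y⟩ := by
  refine lt_of_le_of_ne (F.nonneg _) fun h0 => ?_
  have key : ∀ᶠ s : ℝ in 𝓝 0, deriv (fun t : ℝ =>
      F.norm ⟨x, y + s • y + t • y⟩ ^ 2) 0 = 0 := by
    filter_upwards [lt_mem_nhds (show (-1 : ℝ) < 0 by norm_num)] with s hs
    have : (fun t : ℝ => F.norm ⟨x, y + s • y + t • y⟩ ^ 2) =ᶠ[𝓝 0] fun _ => 0 := by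
      filter_upwards [lt_mem_nhds (show -(1 + s) < 0 by linarith)] with t ht
      have e : y + s • y + t • y = (1 + s + t) • y := by module
      rw [e, F.homogeneous x y _ (by linarith), ← h0]
      simp
    rw [this.deriv_eq]; simp
  have h := F.posDef x y y hy hy
  rw [Filter.EventuallyEq.deriv_eq key] at h
  simp at h

/-- The total space `𝓘M` of the indicatrix bundle: the tangent vectors of Finsler norm one. -/
abbrev IndicatrixBundle (F : FinslerStructure n M) : Type _ :=
  {v : TangentBundle (𝓡 (n + 1)) M // F.norm v = 1}

/-- The indicatrix `𝓘_p M` at the point `p`. -/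
abbrev Indicatrix (F : FinslerStructure n M) (p : M) : Type _ :=
  {y : TangentSpace (𝓡 (n + 1)) p // F.norm ⟨p, y⟩ = 1}

/-! ### The smooth structure of the indicatrix bundle

The indicatrix bundle is an embedded submanifold of `TM`. Over a chart domain of `M`, where `TM` is
trivial, radial projection identifies it with the product of the domain and the unit sphere. -/

/-- The vector `v / 𝓕(v)` of the indicatrix bundle, for `v ≠ 0`. -/
def normalize (F : FinslerStructure n M) (x : M) (y : TangentSpace (𝓡 (n + 1)) x)
    (hy : y ≠ 0) : F.IndicatrixBundle :=
  ⟨⟨x, (F.norm ⟨x, y⟩)⁻¹ • y⟩, by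
    rw [F.homogeneous x y _ (inv_pos.2 (F.norm_pos hy)), inv_mul_cancel₀ (F.norm_pos hy).ne']⟩

theorem snd_ne_zero (F : FinslerStructure n M) (v : F.IndicatrixBundle) : v.1.2 ≠ 0 := by
  intro h
  have h1 : F.norm ⟨v.1.1, v.1.2⟩ = 1 := v.2
  rw [h, F.norm_zero] at h1
  exact zero_ne_one h1

end FinslerStructure

open Classical in
/-- Radial projection to the unit sphere, with an arbitrary value at the origin. -/
def toUnitSphere (n : ℕ) (y : EuclideanSpace ℝ (Fin (n + 1))) :
    Metric.sphere (0 : EuclideanSpace ℝ (Fin (n + 1))) 1 :=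
  if hy : y = 0 then ⟨EuclideanSpace.single 0 1, by simp⟩
  else ⟨‖y‖⁻¹ • y, by simp [norm_smul, hy]⟩

theorem toUnitSphere_coe {n : ℕ} {y : EuclideanSpace ℝ (Fin (n + 1))} (hy : y ≠ 0) :
    (toUnitSphere n y : EuclideanSpace ℝ (Fin (n + 1))) = ‖y‖⁻¹ • y := by
  simp [toUnitSphere, hy]

theorem contMDiffOn_toUnitSphere (n : ℕ) :
    ContMDiffOn 𝓘(ℝ, EuclideanSpace ℝ (Fin (n + 1))) (𝓡 n) ∞ (toUnitSphere n) {0}ᶜ := by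
  let U : TopologicalSpace.Opens (EuclideanSpace ℝ (Fin (n + 1))) := ⟨{0}ᶜ, isOpen_compl_singleton⟩
  have hU : ∀ y : U, (y : EuclideanSpace ℝ (Fin (n + 1))) ≠ 0 := fun y => y.2
  have h1 : ContMDiff 𝓘(ℝ, EuclideanSpace ℝ (Fin (n + 1))) 𝓘(ℝ, EuclideanSpace ℝ (Fin (n + 1))) ∞
      (fun y : U => ‖(y : EuclideanSpace ℝ (Fin (n + 1)))‖⁻¹ •
        (y : EuclideanSpace ℝ (Fin (n + 1)))) := by
    intro y
    have : ContDiffAt ℝ ∞ (fun y : EuclideanSpace ℝ (Fin (n + 1)) => ‖y‖⁻¹ • y) y :=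
      ((contDiffAt_norm ℝ (hU y)).inv (norm_ne_zero_iff.2 (hU y))).smul contDiffAt_id
    exact this.contMDiffAt.comp y contMDiff_subtype_val.contMDiffAt
  have : Fact (Module.finrank ℝ (EuclideanSpace ℝ (Fin (n + 1))) = n + 1) := ⟨by simp⟩
  have h2 := h1.codRestrict_sphere (n := n) (fun y => by simp [norm_smul, hU y])
  intro y hy
  refine ContMDiffAt.contMDiffWithinAt ?_
  refine (contMDiffAt_subtype_iff (U := U) (x := ⟨y, hy⟩)).1 ?_
  refine (h2 ⟨y, hy⟩).congr_of_eventuallyEq (Filter.Eventually.of_forall fun z => ?_)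
  exact Subtype.ext (toUnitSphere_coe (hU z))

theorem toUnitSphere_smul {n : ℕ} {a : ℝ} (ha : 0 < a) {y : EuclideanSpace ℝ (Fin (n + 1))}
    (hy : y ≠ 0) : toUnitSphere n (a • y) = toUnitSphere n y := by
  refine Subtype.ext ?_
  rw [toUnitSphere_coe hy, toUnitSphere_coe (smul_ne_zero ha.ne' hy), norm_smul, smul_smul,
    Real.norm_of_nonneg ha.le]
  congr 1
  field_simp

theorem toUnitSphere_self {n : ℕ}
    (u : Metric.sphere (0 : EuclideanSpace ℝ (Fin (n + 1))) 1) :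
    toUnitSphere n u = u := by
  refine Subtype.ext ?_
  rw [toUnitSphere_coe (ne_zero_of_mem_unit_sphere u)]
  simp

namespace FinslerStructure

variable (F : FinslerStructure n M)

/-- The standard local trivialization of `TM` around `p`. -/
abbrev tangentTriv (n : ℕ) {M : Type*} [TopologicalSpace M]
    [ChartedSpace (EuclideanSpace ℝ (Fin (n + 1))) M] [IsManifold (𝓡 (n + 1)) ∞ M] (p : M) : Trivialization (EuclideanSpace ℝ (Fin (n + 1)))
    (π (EuclideanSpace ℝ (Fin (n + 1))) (TangentSpace (𝓡 (n + 1)) : M → Type _)) :=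
  trivializationAt (EuclideanSpace ℝ (Fin (n + 1))) (TangentSpace (𝓡 (n + 1)) : M → Type _) p

theorem tangentTriv_ne_zero {p : M}
    {v : TangentBundle (𝓡 (n + 1)) M}
    (hv : v.1 ∈ (tangentTriv n p).baseSet) (h0 : v.2 ≠ 0) : (tangentTriv n p v).2 ≠ 0 := by
  intro h
  apply h0
  have := (tangentTriv n p).symm_apply_apply_mk hv v.2
  rw [← this, show (tangentTriv n p ⟨v.1, v.2⟩).2 = 0 from h,
    ← (tangentTriv n p).symmₗ_apply (R := ℝ) hv, map_zero]

theorem tangentTriv_symm_ne_zero {p x : M} (hx : x ∈ (tangentTriv n p).baseSet)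
    {u : EuclideanSpace ℝ (Fin (n + 1))} (hu : u ≠ 0) : (tangentTriv n p).symm x u ≠ 0 := by
  intro h0
  have h2 := congrArg Prod.snd ((tangentTriv n p).apply_mk_symm hx u)
  rw [h0, ((tangentTriv n p).linear ℝ hx).map_zero] at h2
  exact hu h2.symm

theorem tangentTriv_symm_smul {p x : M} (hx : x ∈ (tangentTriv n p).baseSet) (a : ℝ)
    (u : EuclideanSpace ℝ (Fin (n + 1))) :
    (tangentTriv n p).symm x (a • u) = a • (tangentTriv n p).symm x u := by
  rw [← (tangentTriv n p).symmₗ_apply (R := ℝ) hx, ← (tangentTriv n p).symmₗ_apply (R := ℝ) hx,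
    map_smul]

open Classical in
/-- The vector of the indicatrix bundle at `q.1` on the ray which the trivialization of `TM`
around `p` maps to the ray through `q.2` (with an arbitrary value outside the domain of the
trivialization). -/
def sphereBundleInv (p : M)
    (q : M × Metric.sphere (0 : EuclideanSpace ℝ (Fin (n + 1))) 1) : F.IndicatrixBundle :=
  if h : q.1 ∈ (tangentTriv n p).baseSet then
    F.normalize q.1 ((tangentTriv n p).symm q.1 (q.2 : EuclideanSpace ℝ (Fin (n + 1))))
      (tangentTriv_symm_ne_zero h (ne_zero_of_mem_unit_sphere q.2))
  else F.normalize q.1 (q.2 : EuclideanSpace ℝ (Fin (n + 1))) (ne_zero_of_mem_unit_sphere q.2)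

theorem sphereBundleInv_fst {p : M}
    {q : M × Metric.sphere (0 : EuclideanSpace ℝ (Fin (n + 1))) 1}
    (h : q.1 ∈ (tangentTriv n p).baseSet) : (F.sphereBundleInv p q).1.1 = q.1 := by
  rw [sphereBundleInv, dif_pos h, normalize]

theorem sphereBundleInv_coe {p : M}
    {q : M × Metric.sphere (0 : EuclideanSpace ℝ (Fin (n + 1))) 1}
    (h : q.1 ∈ (tangentTriv n p).baseSet) :
    (F.sphereBundleInv p q).1 = (tangentTriv n p).toOpenPartialHomeomorph.symm
      (q.1, (F.norm ((tangentTriv n p).toOpenPartialHomeomorph.symm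
        (q.1, (q.2 : EuclideanSpace ℝ (Fin (n + 1))))))⁻¹ •
          (q.2 : EuclideanSpace ℝ (Fin (n + 1)))) := by
  rw [← (tangentTriv n p).mk_symm h, ← (tangentTriv n p).mk_symm h, sphereBundleInv, dif_pos h,
    normalize, tangentTriv_symm_smul h]

/-- Radial projection from the indicatrix bundle over the domain of the trivialization of `TM`
around `p` to the product of the domain and the unit sphere. -/
def sphereBundleTriv (p : M) : OpenPartialHomeomorph F.IndicatrixBundle
    (M × Metric.sphere (0 : EuclideanSpace ℝ (Fin (n + 1))) 1) where
  toFun v := (v.1.1, toUnitSphere n (tangentTriv n p v.1).2)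
  invFun := F.sphereBundleInv p
  source := {v | v.1.1 ∈ (tangentTriv n p).baseSet}
  target := (tangentTriv n p).baseSet ×ˢ univ
  map_source' v hv := ⟨hv, mem_univ _⟩
  map_target' q hq := by
    change (F.sphereBundleInv p q).1.1 ∈ (tangentTriv n p).baseSet
    rw [F.sphereBundleInv_fst hq.1]
    exact hq.1
  left_inv' v hv := by
    have hv' : v.1.1 ∈ (tangentTriv n p).baseSet := hv
    have hne := tangentTriv_ne_zero hv' (F.snd_ne_zero v)
    have hpos := norm_pos_iff.2 hne
    refine Subtype.ext ?_
    rw [F.sphereBundleInv_coe hv']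
    have key : ∀ a : ℝ, (tangentTriv n p).toOpenPartialHomeomorph.symm
        (v.1.1, a • (tangentTriv n p v.1).2) = ⟨v.1.1, a • v.1.2⟩ := by
      intro a
      rw [← (tangentTriv n p).mk_symm hv', ← (tangentTriv n p).symmₗ_apply (R := ℝ) hv', map_smul,
        (tangentTriv n p).symmₗ_apply (R := ℝ) hv']
      congr 2
      exact (tangentTriv n p).symm_apply_apply_mk hv' v.1.2
    have h1 : F.norm ⟨v.1.1, v.1.2⟩ = 1 := v.2
    dsimp only
    rw [toUnitSphere_coe hne, key, F.homogeneous _ _ _ (inv_pos.2 hpos), h1, smul_smul, key]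
    rw [mul_one, inv_inv, mul_inv_cancel₀ hpos.ne', one_smul]
  right_inv' q hq := by
    have hpos : 0 < F.norm ((tangentTriv n p).toOpenPartialHomeomorph.symm
        (q.1, (q.2 : EuclideanSpace ℝ (Fin (n + 1))))) := by
      rw [← (tangentTriv n p).mk_symm hq.1]
      exact F.norm_pos (tangentTriv_symm_ne_zero hq.1 (ne_zero_of_mem_unit_sphere q.2))
    refine Prod.ext (F.sphereBundleInv_fst hq.1) ?_
    change toUnitSphere n (tangentTriv n p (F.sphereBundleInv p q).1).2 = _
    rw [F.sphereBundleInv_coe hq.1, (tangentTriv n p).apply_symm_apply' hq.1,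
      toUnitSphere_smul (inv_pos.2 hpos) (ne_zero_of_mem_unit_sphere q.2), toUnitSphere_self]
  open_source := (tangentTriv n p).open_baseSet.preimage
    ((FiberBundle.continuous_proj _ _).comp continuous_subtype_val)
  open_target := (tangentTriv n p).open_baseSet.prod isOpen_univ
  continuousOn_toFun := by
    refine ((FiberBundle.continuous_proj _ _).comp continuous_subtype_val).continuousOn.prodMk ?_
    refine (contMDiffOn_toUnitSphere n).continuousOn.comp
      (t := {0}ᶜ) (f := fun v : F.IndicatrixBundle => (tangentTriv n p v.1).2) ?_ ?_
    · refine continuous_snd.comp_continuousOn ?_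
      exact (tangentTriv n p).continuousOn.comp continuous_subtype_val.continuousOn
        fun v hv => (tangentTriv n p).mem_source.2 hv
    · exact fun v hv => tangentTriv_ne_zero hv (F.snd_ne_zero v)
  continuousOn_invFun := by
    refine Topology.IsInducing.subtypeVal.continuousOn_iff.2 ?_
    have hc : ContinuousOn (fun q : M × Metric.sphere (0 : EuclideanSpace ℝ (Fin (n + 1))) 1 =>
        F.norm ((tangentTriv n p).toOpenPartialHomeomorph.symm
          (q.1, (q.2 : EuclideanSpace ℝ (Fin (n + 1)))))) ((tangentTriv n p).baseSet ×ˢ univ) := by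
      refine F.continuous_norm.comp_continuousOn ?_
      refine (tangentTriv n p).toOpenPartialHomeomorph.continuousOn_symm.comp
        (by fun_prop) fun q hq => ?_
      exact (tangentTriv n p).mem_target.2 hq.1
    refine ContinuousOn.congr (f := fun q : M ×
        Metric.sphere (0 : EuclideanSpace ℝ (Fin (n + 1))) 1 => (tangentTriv n p).toOpenPartialHomeomorph.symm
      (q.1, (F.norm ((tangentTriv n p).toOpenPartialHomeomorph.symm
        (q.1, (q.2 : EuclideanSpace ℝ (Fin (n + 1))))))⁻¹ •
          (q.2 : EuclideanSpace ℝ (Fin (n + 1))))) ?_ fun q hq => F.sphereBundleInv_coe hq.1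
    refine (tangentTriv n p).toOpenPartialHomeomorph.continuousOn_symm.comp ?_ fun q hq => ?_
    · refine continuous_fst.continuousOn.prodMk (ContinuousOn.smul (hc.inv₀ fun q hq => ?_)
        (by fun_prop))
      rw [← (tangentTriv n p).mk_symm hq.1]
      exact (F.norm_pos (tangentTriv_symm_ne_zero hq.1 (ne_zero_of_mem_unit_sphere q.2))).ne'
    · exact (tangentTriv n p).mem_target.2 hq.1

theorem sphereBundleTriv_transition (p p' : M)
    (q : M × Metric.sphere (0 : EuclideanSpace ℝ (Fin (n + 1))) 1)
    (hq : q.1 ∈ (tangentTriv n p).baseSet ∩ (tangentTriv n p').baseSet) :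
    F.sphereBundleTriv p' ((F.sphereBundleTriv p).symm q) =
      (q.1, toUnitSphere n ((tangentTriv n p).coordChangeL ℝ (tangentTriv n p') q.1 q.2)) := by
  change ((F.sphereBundleInv p q).1.1, toUnitSphere n (tangentTriv n p' (F.sphereBundleInv p q).1).2)
    = _
  have hpos : 0 < F.norm ((tangentTriv n p).toOpenPartialHomeomorph.symm
      (q.1, (q.2 : EuclideanSpace ℝ (Fin (n + 1))))) := by
    rw [← (tangentTriv n p).mk_symm hq.1]
    exact F.norm_pos (tangentTriv_symm_ne_zero hq.1 (ne_zero_of_mem_unit_sphere q.2))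
  refine Prod.ext (F.sphereBundleInv_fst hq.1) ?_
  change toUnitSphere n (tangentTriv n p' (F.sphereBundleInv p q).1).2 = _
  rw [F.sphereBundleInv_coe hq.1]
  rw [(tangentTriv n p).apply_symm_apply_eq_coordChangeL (R := ℝ) (tangentTriv n p') hq, map_smul]
  refine toUnitSphere_smul (inv_pos.2 hpos) ?_
  rw [Ne, ContinuousLinearEquiv.map_eq_zero_iff]
  exact ne_zero_of_mem_unit_sphere q.2

theorem contMDiffOn_transition (p p' : M) :
    ContMDiffOn ((𝓡 (n + 1)).prod (𝓡 n)) ((𝓡 (n + 1)).prod (𝓡 n)) ∞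
      (fun q => F.sphereBundleTriv p' ((F.sphereBundleTriv p).symm q))
      (((tangentTriv n p).baseSet ∩ (tangentTriv n p').baseSet) ×ˢ univ) := by
  refine ContMDiffOn.congr ?_ fun q hq => F.sphereBundleTriv_transition p p' q hq.1
  refine contMDiffOn_fst.prodMk ?_
  refine (contMDiffOn_toUnitSphere n).comp
    (f := fun q : M × Metric.sphere (0 : EuclideanSpace ℝ (Fin (n + 1))) 1 =>
      (tangentTriv n p).coordChangeL ℝ (tangentTriv n p') q.1 q.2) ?_ ?_
  · have h := (contMDiffOn_coordChangeL (n := ∞) (IB := 𝓡 (n + 1)) (tangentTriv n p)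
      (tangentTriv n p')).comp (contMDiffOn_fst (J := 𝓡 n)
        (N := Metric.sphere (0 : EuclideanSpace ℝ (Fin (n + 1))) 1) (s := ((tangentTriv n p).baseSet ∩
        (tangentTriv n p').baseSet) ×ˢ univ)) fun q hq => hq.1
    refine h.clm_apply ?_
    have : Fact (Module.finrank ℝ (EuclideanSpace ℝ (Fin (n + 1))) = n + 1) := ⟨by simp⟩
    exact (contMDiff_coe_sphere.comp contMDiff_snd).contMDiffOn
  · intro q _
    rw [mem_preimage, mem_compl_singleton_iff, Ne, ContinuousLinearEquiv.map_eq_zero_iff]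
    exact ne_zero_of_mem_unit_sphere q.2

/-- The indicatrix bundle as a bundle over `M` with the unit sphere as fibre. -/
abbrev sphereBundleChartedSpace :
    ChartedSpace (M × Metric.sphere (0 : EuclideanSpace ℝ (Fin (n + 1))) 1) F.IndicatrixBundle where
  atlas := range F.sphereBundleTriv
  chartAt v := F.sphereBundleTriv v.1.1
  mem_chart_source v := mem_baseSet_trivializationAt (EuclideanSpace ℝ (Fin (n + 1)))
    (TangentSpace (𝓡 (n + 1)) : M → Type _) v.1.1
  chart_mem_atlas v := mem_range_self v.1.1

/-- The charts of the indicatrix bundle are the local trivializations followed by a chart of `M`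
and a stereographic chart of the unit sphere. -/
instance instChartedSpaceIndicatrixBundle :
    ChartedSpace (ModelProd (EuclideanSpace ℝ (Fin (n + 1))) (EuclideanSpace ℝ (Fin n)))
      F.IndicatrixBundle :=
  letI := F.sphereBundleChartedSpace
  ChartedSpace.comp _ (M × Metric.sphere (0 : EuclideanSpace ℝ (Fin (n + 1))) 1) _

instance instIsManifoldIndicatrixBundle :
    IsManifold ((𝓡 (n + 1)).prod (𝓡 n)) ∞ F.IndicatrixBundle := by
  refine isManifold_of_contDiffOn _ _ _ ?_
  intro e e' he he'
  obtain ⟨_, ⟨p, rfl⟩, c, hc, rfl⟩ : ∃ a ∈ range F.sphereBundleTriv, ∃ c ∈ atlas _ _,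
    a.trans c = e := he
  obtain ⟨_, ⟨p', rfl⟩, c', hc', rfl⟩ : ∃ a ∈ range F.sphereBundleTriv, ∃ c ∈ atlas _ _,
    a.trans c = e' := he'
  have h1 := contMDiffOn_symm_of_mem_maximalAtlas
    (IsManifold.subset_maximalAtlas (I := (𝓡 (n + 1)).prod (𝓡 n)) (n := ∞) hc)
  have h2 := contMDiffOn_of_mem_maximalAtlas
    (IsManifold.subset_maximalAtlas (I := (𝓡 (n + 1)).prod (𝓡 n)) (n := ∞) hc')
  have h3 : ContMDiffOn ((𝓡 (n + 1)).prod (𝓡 n)) ((𝓡 (n + 1)).prod (𝓡 n)) ∞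
      (((F.sphereBundleTriv p).trans c).symm.trans ((F.sphereBundleTriv p').trans c'))
      (((F.sphereBundleTriv p).trans c).symm.trans ((F.sphereBundleTriv p').trans c')).source := by
    have h4 := (h2.comp' (F.contMDiffOn_transition p p')).comp' h1
    refine h4.mono ?_
    intro z hz
    have hz3 : ((F.sphereBundleTriv p).symm (c.symm z)).1.1 ∈ (tangentTriv n p').baseSet :=
      hz.2.1
    have hz4 : c.symm z ∈ (F.sphereBundleTriv p).target := hz.1.2
    have hz5 : (c.symm z).1 ∈ (tangentTriv n p').baseSet := by
      rw [← F.sphereBundleInv_fst hz4.1]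
      exact hz3
    simp only [mfld_simps] at hz
    exact ⟨hz.1.1, ⟨⟨hz.1.2.1, hz5⟩, mem_univ _⟩, hz.2.2⟩
  exact contDiffOn_of_contMDiffOn_model _ h3

theorem contMDiff_indicatrix_coe :
    ContMDiff ((𝓡 (n + 1)).prod (𝓡 n)) (𝓡 (n + 1)).tangent ∞
      (Subtype.val : F.IndicatrixBundle → TangentBundle (𝓡 (n + 1)) M) := by
  intro v
  have hb : v.1.1 ∈ (tangentTriv n v.1.1).baseSet :=
    mem_baseSet_trivializationAt (EuclideanSpace ℝ (Fin (n + 1)))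
      (TangentSpace (𝓡 (n + 1)) : M → Type _) v.1.1
  have hA : ContMDiffAt ((𝓡 (n + 1)).prod (𝓡 n)) ((𝓡 (n + 1)).prod (𝓡 n)) ∞
      (F.sphereBundleTriv v.1.1) v :=
    contMDiffAt_iff_target.2 ⟨(F.sphereBundleTriv v.1.1).continuousAt hb,
      contMDiffAt_extChartAt (I := (𝓡 (n + 1)).prod (𝓡 n)) (x := v)⟩
  have hS : ContMDiff ((𝓡 (n + 1)).prod (𝓡 n)) 𝓘(ℝ, EuclideanSpace ℝ (Fin (n + 1))) ∞
      (fun q : M × Metric.sphere (0 : EuclideanSpace ℝ (Fin (n + 1))) 1 =>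
        (q.2 : EuclideanSpace ℝ (Fin (n + 1)))) := by
    have : Fact (Module.finrank ℝ (EuclideanSpace ℝ (Fin (n + 1))) = n + 1) := ⟨by simp⟩
    exact contMDiff_coe_sphere.comp contMDiff_snd
  have he : ∀ {g : M × Metric.sphere (0 : EuclideanSpace ℝ (Fin (n + 1))) 1 →
      EuclideanSpace ℝ (Fin (n + 1))} {q}, q.1 ∈ (tangentTriv n v.1.1).baseSet →
      ContMDiffAt ((𝓡 (n + 1)).prod (𝓡 n)) 𝓘(ℝ, EuclideanSpace ℝ (Fin (n + 1))) ∞ g q →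
      ContMDiffAt ((𝓡 (n + 1)).prod (𝓡 n)) (𝓡 (n + 1)).tangent ∞
        (fun q => (tangentTriv n v.1.1).toOpenPartialHomeomorph.symm (q.1, g q)) q := by
    intro g q hq hg
    have hm : (q.1, g q) ∈ (tangentTriv n v.1.1).target := (tangentTriv n v.1.1).mem_target.2 hq
    have := (((tangentTriv n v.1.1).contMDiffOn_symm (n := ∞) (IB := 𝓡 (n + 1))).contMDiffAt
      ((tangentTriv n v.1.1).open_target.mem_nhds hm))
    exact this.comp (f := fun q => (q.1, g q)) q (contMDiffAt_fst.prodMk hg)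
  set q₀ := F.sphereBundleTriv v.1.1 v with hq₀
  have hq : q₀.1 ∈ (tangentTriv n v.1.1).baseSet := hb
  have hne : ((tangentTriv n v.1.1).toOpenPartialHomeomorph.symm
      (q₀.1, (q₀.2 : EuclideanSpace ℝ (Fin (n + 1))))).2 ≠ 0 := by
    rw [← (tangentTriv n v.1.1).mk_symm hq]
    exact tangentTriv_symm_ne_zero hq (ne_zero_of_mem_unit_sphere q₀.2)
  have hopen : {w : TangentBundle (𝓡 (n + 1)) M | w.2 ≠ 0} ∈ 𝓝
      ((tangentTriv n v.1.1).toOpenPartialHomeomorph.symm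
        (q₀.1, (q₀.2 : EuclideanSpace ℝ (Fin (n + 1))))) := by
    have h0 : {w : TangentBundle (𝓡 (n + 1)) M | w.2 ≠ 0} = {w | 0 < F.norm w} := by
      ext w
      refine ⟨fun h => F.norm_pos h, fun h h' => ?_⟩
      have h1 : 0 < F.norm ⟨w.1, w.2⟩ := h
      rw [h', F.norm_zero] at h1
      exact lt_irrefl _ h1
    rw [h0]
    exact (isOpen_lt continuous_const F.continuous_norm).mem_nhds (F.norm_pos hne)
  have hN := ((F.smooth.contMDiffAt hopen).comp q₀ (he hq hS.contMDiffAt)).inv₀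
    (F.norm_pos hne).ne'
  have hfin := (he hq (hN.smul hS.contMDiffAt)).comp v hA
  refine hfin.congr_of_eventuallyEq ?_
  filter_upwards [(F.sphereBundleTriv v.1.1).open_source.mem_nhds hb] with w hw
  have h3 := (F.sphereBundleTriv v.1.1).left_inv hw
  have h4 := F.sphereBundleInv_coe (q := F.sphereBundleTriv v.1.1 w) hw
  exact (congrArg Subtype.val h3).symm.trans h4

/-- The smooth structure above is the one of an embedded submanifold of `TM`: a map into the
indicatrix bundle is smooth if and only if it is smooth as a map into `TM`. -/
theorem contMDiff_indicatrix_iff {E' : Type*} [NormedAddCommGroup E'] [NormedSpace ℝ E']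
    {H' : Type*} [TopologicalSpace H'] {J : ModelWithCorners ℝ E' H'}
    {P : Type*} [TopologicalSpace P] [ChartedSpace H' P] {f : P → F.IndicatrixBundle} :
    ContMDiff J ((𝓡 (n + 1)).prod (𝓡 n)) ∞ f ↔
      ContMDiff J (𝓡 (n + 1)).tangent ∞ (fun x => (f x).1) := by
  refine ⟨fun h => F.contMDiff_indicatrix_coe.comp h, fun h x => ?_⟩
  have hfc : Continuous f := Topology.IsInducing.subtypeVal.continuous_iff.2 h.continuous
  refine contMDiffAt_iff_target.2 ⟨hfc.continuousAt, ?_⟩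
  have h1 : ContMDiffAt J ((𝓡 (n + 1)).prod (𝓡 n)) ∞
      (fun y => F.sphereBundleTriv (f x).1.1 (f y)) x := by
    have hb : (f x).1.1 ∈ (tangentTriv n (f x).1.1).baseSet := 
      mem_baseSet_trivializationAt (EuclideanSpace ℝ (Fin (n + 1)))
        (TangentSpace (𝓡 (n + 1)) : M → Type _) (f x).1.1
    have h2 := ((tangentTriv n (f x).1.1).contMDiffAt_iff (n := ∞) (IB := 𝓡 (n + 1))
      (f := fun y => (f y).1) (x₀ := x) (IM := J) ((tangentTriv n (f x).1.1).mem_source.2 hb)).1 (h x)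
    refine h2.1.prodMk ?_
    have hne := tangentTriv_ne_zero hb (F.snd_ne_zero (f x))
    exact ((contMDiffOn_toUnitSphere n).contMDiffAt (isOpen_compl_singleton.mem_nhds hne)).comp x h2.2
  exact (contMDiffAt_iff_target.1 h1).2

/-! ### Parallel translation -/

/-- The Finsler norm in the local coordinates `(x, y)` of `TM` induced by the chart of
`M` around `x₀`. -/
def localNorm (x₀ : M) (a b : EuclideanSpace ℝ (Fin (n + 1))) : ℝ :=
  F.norm ((extChartAt (𝓡 (n + 1)).tangent (⟨x₀, 0⟩ : TangentBundle (𝓡 (n + 1)) M)).symm (a, b))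

/-- The coefficients `g_ij(x, y) = ½ ∂²𝓕²(x, y + s eᵢ + t eⱼ)/∂s∂t` at `s = t = 0`. -/
def metricCoeff (x₀ : M) (a b : EuclideanSpace ℝ (Fin (n + 1))) :
    Matrix (Fin (n + 1)) (Fin (n + 1)) ℝ :=
  Matrix.of fun i j => (1 / 2 : ℝ) * deriv (fun s : ℝ => deriv (fun t : ℝ =>
    F.localNorm x₀ a (b + s • EuclideanSpace.single i 1 + t • EuclideanSpace.single j 1) ^ 2) 0) 0

/-- The geodesic coefficients,
`4 Gⁱ = g^{il} (2 ∂g_jl/∂x^k - ∂g_jk/∂x^l) y^j y^k` (summed over `j`, `k`, `l`). -/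
def geodesicCoeff (x₀ : M) (i : Fin (n + 1)) (a b : EuclideanSpace ℝ (Fin (n + 1))) : ℝ :=
  (1 / 4 : ℝ) * ∑ j, ∑ k, ∑ l, (F.metricCoeff x₀ a b)⁻¹ i l *
    (2 * lineDeriv ℝ (fun a' => F.metricCoeff x₀ a' b j l) a (EuclideanSpace.single k 1)
      - lineDeriv ℝ (fun a' => F.metricCoeff x₀ a' b j k) a (EuclideanSpace.single l 1)) *
    b j * b k

/-- The connection coefficients `Gⁱ_j = ∂Gⁱ/∂y^j`. -/
def connectionCoeff (x₀ : M) (i j : Fin (n + 1)) (a b : EuclideanSpace ℝ (Fin (n + 1))) : ℝ :=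
  lineDeriv ℝ (fun b' => F.geodesicCoeff x₀ i a b') b (EuclideanSpace.single j 1)

/-- `X` is a vector field along the curve `c`, and `dXⁱ/dt + Gⁱ_j(c, X) dc^j/dt = 0` on the set
`s`, in all the charts of `M`. -/
def IsParallelOn (c : ℝ → M) (X : ℝ → TangentBundle (𝓡 (n + 1)) M) (s : Set ℝ) : Prop :=
  (∀ t ∈ s, (X t).proj = c t) ∧
  ∀ (x₀ : M), ∀ t ∈ s, c t ∈ (chartAt (EuclideanSpace ℝ (Fin (n + 1))) x₀).source →
    ∀ i : Fin (n + 1),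
      HasDerivWithinAt (fun r => (tangentTriv n x₀ (X r)).2 i)
        (-∑ j, F.connectionCoeff x₀ i j (extChartAt (𝓡 (n + 1)) x₀ (c t)) (tangentTriv n x₀ (X t)).2
          * derivWithin (fun r => extChartAt (𝓡 (n + 1)) x₀ (c r) j) s t) s t

/-- `0 = τ 0 < τ 1 < … < τ m = 1`. -/
def IsSubdivision (m : ℕ) (τ : Fin (m + 1) → ℝ) : Prop :=
  StrictMono τ ∧ τ 0 = 0 ∧ τ (Fin.last m) = 1

/-- `c : [0, 1] → M` is a piecewise continuously differentiable curve, and `X` is a parallel vector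
field along `c`. -/
def IsParallelAlong (c : ℝ → M) (X : ℝ → TangentBundle (𝓡 (n + 1)) M) : Prop :=
  ∃ (m : ℕ) (τ : Fin (m + 1) → ℝ), IsSubdivision m τ ∧ ∀ i : Fin m,
    ContMDiffOn 𝓘(ℝ, ℝ) (𝓡 (n + 1)) 1 c (Icc (τ i.castSucc) (τ i.succ)) ∧
    F.IsParallelOn c X (Icc (τ i.castSucc) (τ i.succ))

/-- `σ : 𝓘_p M → 𝓘_p M` is the parallel translation along the closed piecewise continuously
differentiable curve `c` starting at `p`. -/
def IsParallelTranslation (p : M) (c : ℝ → M) (σ : Equiv.Perm (F.Indicatrix p)) : Prop :=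
  c 0 = p ∧ c 1 = p ∧ ∀ y : F.Indicatrix p, ∃ X : ℝ → TangentBundle (𝓡 (n + 1)) M,
    F.IsParallelAlong c X ∧ X 0 = ⟨p, y.1⟩ ∧ X 1 = ⟨p, (σ y).1⟩

/-! ### Holonomy -/

/-- The holonomy group at `p`, generated by the parallel translations along closed curves. -/
def holonomyGroup (p : M) : Subgroup (Equiv.Perm (F.Indicatrix p)) :=
  Subgroup.closure {σ | ∃ c : ℝ → M, F.IsParallelTranslation p c σ}

/-- The fibered holonomy group: the group generated by the diffeomorphisms of the indicatrix bundle
which map every fibre `𝓘_p M` to itself by an element of the holonomy group at `p`. -/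
def fiberedHolonomyGroup : Subgroup (F.IndicatrixBundle
    ≃ₘ^∞⟮(𝓡 (n + 1)).prod (𝓡 n), (𝓡 (n + 1)).prod (𝓡 n)⟯ F.IndicatrixBundle) :=
  Subgroup.closure {Φ | ∀ p : M, ∃ σ ∈ F.holonomyGroup p, ∀ y : F.Indicatrix p,
    (Φ ⟨⟨p, y.1⟩, y.2⟩).1 = ⟨p, (σ y).1⟩}

/-- The fibered holonomy algebra: the set of vector fields on the indicatrix bundle which are
tangent to the fibered holonomy group. -/
def fiberedHolonomyAlgebra :
    Set (SmoothVectorField ((𝓡 (n + 1)).prod (𝓡 n)) F.IndicatrixBundle) :=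
  tangentAlgebra F.fiberedHolonomyGroup

end FinslerStructure

end Finsler

/-! ### Taylor estimates at zero, for curves and for families of curves. -/

section TaylorExpansion

open Filter Asymptotics

variable {E F : Type*} [NormedAddCommGroup E] [NormedSpace ℝ E]
  [NormedAddCommGroup F] [NormedSpace ℝ F]

/-! The theorem holds for every subgroup G of the diffeomorphism group of a boundaryless manifold N
modelled on a complete space; the holonomy group enters only as a subgroup.

Tangency of order k means that, in the preferred chart at each p, φ_t(p) = p + (t^k / k!) X(p) +
o(t^k). The factor k! is harmless, since replacing t by c^(1/k) t multiplies the leading coefficient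
by any c > 0. Thus X is tangent to G exactly when it is a leading coefficient, of some order k ≥ 1,
of a smooth curve in G through the identity (`isTangentTo_iff_isLeadingField`).

Operations on curves become operations on leading coefficients. Inverses change the sign, and the
substitution t ↦ t^l changes the order from k to kl; so two fields can be brought to a common order,
where composition adds them. The commutator of curves of orders k and l has order k + l, and its
coefficient is the Lie bracket (`IsDiffeoCurve.hasLeadingTerm_commutator`).

The analytic core is `isLittleO_increment`. Applied to the displacement h(t, y) = φ_t(y) - y, it
gives h(t, y) - h(t, p) = t^k DX(p)(y - p) + o(t^k |y - p|), jointly in t and y. With y = ψ_t(p),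
where ψ has order l and coefficient Y, this becomes φ_t ψ_t p - φ_t p - ψ_t p + p = t^(k+l) DX·Y +
o(t^(k+l)). Exchanging φ and ψ and subtracting leaves DX·Y - DY·X, the bracket of Y and X. The
leading terms are only assumed pointwise in p; joint smoothness of the curve supplies the
uniformity. -/

theorem ContDiffAt.eventually_differentiableAt {f : E → F} {x : E} (hf : ContDiffAt ℝ ∞ f x) :
    ∀ᶠ y in 𝓝 x, DifferentiableAt ℝ f y := by
  have h1 : ContDiffAt ℝ 1 f x := hf.of_le (by exact_mod_cast le_top)
  filter_upwards [h1.eventually (by simp)] with y hy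
  exact hy.differentiableAt (by simp)

theorem ContDiffAt.deriv_infty {f : ℝ → F} {x : ℝ} (hf : ContDiffAt ℝ ∞ f x) :
    ContDiffAt ℝ ∞ (deriv f) x := by
  have h : ContDiffAt ℝ ∞ (fun y => fderiv ℝ f y 1) x :=
    (hf.fderiv_right (m := ∞) (by simp)).clm_apply contDiffAt_const
  exact h.congr_of_eventuallyEq (Eventually.of_forall fun y => (fderiv_apply_one_eq_deriv).symm)

/-- The partial derivative of a smooth function of `(t, y)` with respect to the real variable. -/
theorem ContDiffAt.partialDeriv {h : ℝ × E → F} {q₀ : ℝ × E} (hh : ContDiffAt ℝ ∞ h q₀) :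
    ContDiffAt ℝ ∞ (fun q : ℝ × E => deriv (fun t => h (t, q.2)) q.1) q₀ := by
  have h1 : ContDiffAt ℝ ∞ (fun q => fderiv ℝ h q (1, 0)) q₀ :=
    (hh.fderiv_right (m := ∞) (by simp)).clm_apply contDiffAt_const
  refine h1.congr_of_eventuallyEq ?_
  filter_upwards [hh.eventually_differentiableAt] with q hq
  have h2 : HasDerivAt (fun t : ℝ => (t, q.2)) ((1 : ℝ), (0 : E)) q.1 :=
    (hasDerivAt_id q.1).prodMk (hasDerivAt_const q.1 q.2)
  exact (hq.hasFDerivAt.comp_hasDerivAt (f := fun t : ℝ => (t, q.2)) q.1 h2).deriv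

theorem hasDerivAt_pow_div_factorial (k : ℕ) (t : ℝ) :
    HasDerivAt (fun s : ℝ => s ^ (k + 1) / (k + 1).factorial) (t ^ k / k.factorial) t := by
  have h := (hasDerivAt_pow (k + 1) t).div_const ((k + 1).factorial : ℝ)
  refine h.congr_deriv ?_
  rw [Nat.factorial_succ]
  push_cast
  have : (k.factorial : ℝ) ≠ 0 := by exact_mod_cast k.factorial_ne_zero
  have : (k : ℝ) + 1 ≠ 0 := by positivity
  field_simp

/-- If the derivatives of `c` at `0` of orders less than `k` vanish, then `c` is the Taylor monomial
of order `k` up to a remainder which is `o(t ^ k)`. -/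
theorem isLittleO_sub_monomial {c : ℝ → F} {k : ℕ} (hc : ContDiffAt ℝ ∞ c 0)
    (h0 : ∀ j < k, iteratedDeriv j c 0 = 0) :
    (fun t => c t - (t ^ k / k.factorial) • iteratedDeriv k c 0) =o[𝓝 0] fun t => t ^ k := by
  induction k generalizing c with
  | zero =>
    simp only [pow_zero, Nat.factorial_zero, Nat.cast_one, div_one, iteratedDeriv_zero, one_smul]
    rw [isLittleO_one_iff, tendsto_sub_nhds_zero_iff]
    exact hc.continuousAt
  | succ k ih =>
    have h1 := ih hc.deriv_infty fun j hj => by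
      rw [← iteratedDeriv_succ']; exact h0 _ (by omega)
    rw [← iteratedDeriv_succ'] at h1
    obtain ⟨δ, hδ, hd⟩ := Metric.eventually_nhds_iff_ball.1 hc.eventually_differentiableAt
    have hm : Metric.ball (0 : ℝ) δ ∈ 𝓝 0 := Metric.ball_mem_nhds 0 hδ
    -- Integration of the estimate: a function whose derivative is o(t^k) differs from its value at
    -- 0 by o(t^(k+1)), and that value vanishes by the hypothesis of order 0.
    have h2 := (convex_ball (0 : ℝ) δ).isLittleO_pow_succ_real (n := k) (x₀ := 0)
      (f := fun t => c t - (t ^ (k + 1) / (k + 1).factorial) • iteratedDeriv (k + 1) c 0)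
      (f' := fun t => deriv c t - (t ^ k / k.factorial) • iteratedDeriv (k + 1) c 0)
      (Metric.mem_ball_self hδ)
      (fun t ht => ((hd t ht).hasDerivAt.sub
        ((hasDerivAt_pow_div_factorial k t).smul_const _)).hasDerivWithinAt)
      (by simpa [nhdsWithin_eq_nhds.2 hm] using h1)
    have h3 : c 0 = 0 := by simpa using h0 0 (by omega)
    simpa [nhdsWithin_eq_nhds.2 hm, h3] using h2

theorem eq_zero_of_pow_smul_isLittleO {w : F} {k : ℕ}
    (h : (fun t : ℝ => t ^ k • w) =o[𝓝 0] fun t : ℝ => t ^ k) : w = 0 := by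
  by_contra hw
  have h1 := h.mono (nhdsWithin_le_nhds (s := {0}ᶜ))
  have h2 : (fun t : ℝ => t ^ k) =O[𝓝[≠] 0] fun t : ℝ => t ^ k • w := by
    refine IsBigO.of_bound (‖w‖⁻¹) (Eventually.of_forall fun t => ?_)
    rw [norm_smul, mul_comm ‖t ^ k‖, inv_mul_cancel_left₀ (norm_ne_zero_iff.2 hw)]
  have h3 := h1.trans_isBigO h2
  have h4 : ∀ᶠ t : ℝ in 𝓝[≠] 0, t ^ k • w ≠ 0 := by
    filter_upwards [self_mem_nhdsWithin] with t ht using smul_ne_zero (pow_ne_zero k ht) hw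
  exact isLittleO_irrefl h4.frequently h3

/-- An expansion alone does not determine derivatives; smoothness is what makes this converse true.
If the derivatives below order j vanish, c is also its Taylor monomial of order j up to o(t^j), and
comparing the two expansions determines the j-th derivative. -/
theorem iteratedDeriv_of_isLittleO {c : ℝ → F} {k : ℕ} {w : F} (hc : ContDiffAt ℝ ∞ c 0)
    (h : (fun t => c t - t ^ k • w) =o[𝓝 0] fun t => t ^ k) :
    (∀ j < k, iteratedDeriv j c 0 = 0) ∧ iteratedDeriv k c 0 = (k.factorial : ℝ) • w := by
  have hlow : ∀ j < k, iteratedDeriv j c 0 = 0 := by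
    intro j
    induction j using Nat.strong_induction_on with
    | _ j ih =>
      intro hj
      have h1 := isLittleO_sub_monomial hc fun i hi => ih i hi (hi.trans hj)
      have hkj : (fun t : ℝ => t ^ k) =o[𝓝 0] fun t : ℝ => t ^ j := isLittleO_pow_pow hj
      have h2 : (fun t : ℝ => t ^ k • w) =o[𝓝 0] fun t : ℝ => t ^ j := by
        refine IsBigO.trans_isLittleO (IsBigO.of_bound ‖w‖ (Eventually.of_forall fun t => ?_)) hkj
        rw [norm_smul, mul_comm]
      have h3 := ((h.trans hkj).add h2).sub h1
      have h4 : (j.factorial : ℝ)⁻¹ • iteratedDeriv j c 0 = 0 := by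
        refine eq_zero_of_pow_smul_isLittleO (k := j) (h3.congr_left fun t => ?_)
        rw [smul_smul, ← div_eq_mul_inv]
        abel
      exact (smul_eq_zero.1 h4).resolve_left
        (inv_ne_zero (by exact_mod_cast j.factorial_ne_zero))
  refine ⟨hlow, ?_⟩
  have hf : (k.factorial : ℝ) ≠ 0 := by exact_mod_cast k.factorial_ne_zero
  have h1 := h.sub (isLittleO_sub_monomial hc hlow)
  have h4 : (k.factorial : ℝ)⁻¹ • iteratedDeriv k c 0 - w = 0 := by
    refine eq_zero_of_pow_smul_isLittleO (k := k) (h1.congr_left fun t => ?_)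
    rw [smul_sub, smul_smul, ← div_eq_mul_inv]
    abel
  rw [← sub_eq_zero.1 h4, smul_smul, mul_inv_cancel₀ hf, one_smul]

/-- If the derivatives of `t ↦ h (t, y)` at `0` of orders less than `k` vanish for all `y` near `x₀`,
then the increment of `h` in the second variable is `t ^ k / k!` times the differential of the
derivative of order `k`, up to `o(t ^ k ‖y - x₀‖)`, jointly in `(t, y)`. -/
theorem isLittleO_increment {h : ℝ × E → F} {x₀ : E} {k : ℕ} (hh : ContDiffAt ℝ ∞ h (0, x₀))
    (h0 : ∀ j < k, ∀ᶠ y in 𝓝 x₀, iteratedDeriv j (fun t => h (t, y)) 0 = 0) :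
    (fun q : ℝ × E => h q - h (q.1, x₀) - (q.1 ^ k / k.factorial) •
      fderiv ℝ (fun y => iteratedDeriv k (fun t => h (t, y)) 0) x₀ (q.2 - x₀))
      =o[𝓝 (0, x₀)] fun q => q.1 ^ k • (q.2 - x₀) := by
  induction k generalizing h with
  -- Strict differentiability is essential: the two points (t, y) and (t, x₀) both move as t varies.
  | zero =>
    have hs : HasStrictFDerivAt h (fderiv ℝ h (0, x₀)) (0, x₀) :=
      hh.hasStrictFDerivAt (by simp)
    have hd : fderiv ℝ (fun y => h (0, y)) x₀ =
        (fderiv ℝ h (0, x₀)).comp (ContinuousLinearMap.inr ℝ ℝ E) :=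
      (hs.hasFDerivAt.comp x₀ (hasFDerivAt_prodMk_right (0 : ℝ) x₀)).fderiv
    have ht : Tendsto (fun q : ℝ × E => (q, (q.1, x₀))) (𝓝 (0, x₀)) (𝓝 ((0, x₀), (0, x₀))) := by
      have : Continuous fun q : ℝ × E => (q, (q.1, x₀)) := by fun_prop
      exact this.tendsto' _ _ rfl
    have h1 := hs.isLittleO.comp_tendsto ht
    simp only [pow_zero, Nat.factorial_zero, Nat.cast_one, div_one, iteratedDeriv_zero, one_smul,
      hd]
    refine (h1.congr_left fun q => ?_).trans_isBigO
      (IsBigO.of_bound 1 (Eventually.of_forall fun q => ?_))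
    · have : q - (q.1, x₀) = (0, q.2 - x₀) := Prod.ext (sub_self _) rfl
      simp only [Function.comp_apply, this, ContinuousLinearMap.comp_apply,
        ContinuousLinearMap.inr_apply]
    · simp [Prod.norm_def]
  | succ k ih =>
    have hp := hh.partialDeriv
    -- The induction hypothesis goes to ∂h/∂t, whose derivative of order k is that of h of order k +
    -- 1, so both estimates involve the same differential D. The estimate for h then follows by
    -- integration in t.
    have h1 := ih hp fun j hj => by
      filter_upwards [h0 (j + 1) (by omega)] with y hy
      rw [iteratedDeriv_succ'] at hy
      exact hy
    simp only [← iteratedDeriv_succ'] at h1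
    set D := fderiv ℝ (fun y => iteratedDeriv (k + 1) (fun t => h (t, y)) 0) x₀ with hD
    clear_value D
    rw [isLittleO_iff] at h1 ⊢
    intro ε hε
    have hz : ∀ᶠ q : ℝ × E in 𝓝 (0, x₀), h (0, q.2) = 0 := by
      have := h0 0 (by omega)
      simp only [iteratedDeriv_zero] at this
      exact (continuous_snd.tendsto' ((0 : ℝ), x₀) x₀ rfl).eventually this
    have hd := hh.eventually_differentiableAt
    obtain ⟨δ, hδ, H⟩ := Metric.eventually_nhds_iff_ball.1 ((h1 hε).and (hz.and hd))
    refine Metric.eventually_nhds_iff_ball.2 ⟨δ, hδ, fun q hq => ?_⟩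
    obtain ⟨t, y⟩ := q
    have hball : ∀ (s : ℝ) (z : E), (s, z) ∈ Metric.ball ((0 : ℝ), x₀) δ ↔
        |s| < δ ∧ dist z x₀ < δ := by
      intro s z
      simp [Prod.dist_eq]
    have hty := (hball t y).1 hq
    have hpd : ∀ (s : ℝ) (z : E), |s| < δ → dist z x₀ < δ →
        HasDerivAt (fun r => h (r, z)) (deriv (fun r => h (r, z)) s) s := by
      intro s z hs hz
      have h2 : DifferentiableAt ℝ (fun r : ℝ => (r, z)) s := by fun_prop
      exact ((H (s, z) ((hball s z).2 ⟨hs, hz⟩)).2.2.comp (f := fun r : ℝ => (r, z)) s h2).hasDerivAt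
    have hx0 : dist x₀ x₀ < δ := by simpa using hδ
    -- The mean value inequality on [-|t|, |t|], which contains 0 and t whatever the sign of t. The
    -- compared function vanishes at 0 because h(0, y) = h(0, x₀) = 0, and the length |t| raises the
    -- exponent from k to k + 1.
    have hmv := (convex_Icc (-|t|) |t|).norm_image_sub_le_of_norm_hasDerivWithin_le
      (f := fun s => h (s, y) - h (s, x₀) - (s ^ (k + 1) / (k + 1).factorial) • D (y - x₀))
      (f' := fun s => deriv (fun r => h (r, y)) s - deriv (fun r => h (r, x₀)) s -
        (s ^ k / k.factorial) • D (y - x₀)) (C := ε * (|t| ^ k * ‖y - x₀‖)) (x := 0) (y := t)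
      (fun s hs => by
        have hs' : |s| < δ := (abs_le.2 hs).trans_lt hty.1
        exact (((hpd s y hs' hty.2).sub (hpd s x₀ hs' hx0)).sub
          ((hasDerivAt_pow_div_factorial k s).smul_const _)).hasDerivWithinAt)
      (fun s hs => by
        have hs' : |s| ≤ |t| := abs_le.2 hs
        refine ((H (s, y) ((hball s y).2 ⟨hs'.trans_lt hty.1, hty.2⟩)).1).trans ?_
        simp only [norm_smul, norm_pow, Real.norm_eq_abs]
        gcongr)
      (by simp) (abs_le.1 le_rfl)
    have hy0 := (H (t, y) hq).2.1
    have hx0' := (H (t, x₀) ((hball t x₀).2 ⟨hty.1, hx0⟩)).2.1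
    simp only at hy0 hx0'
    simp only [hy0, hx0', sub_zero, ne_eq, Nat.add_eq_zero_iff, one_ne_zero, and_false,
      not_false_eq_true, zero_pow, zero_div, zero_smul, Real.norm_eq_abs] at hmv
    refine hmv.trans (le_of_eq ?_)
    simp only [norm_smul, norm_pow, Real.norm_eq_abs]
    ring

end TaylorExpansion

/-! ### Smooth curves of diffeomorphisms: products, reparametrizations, inverses. -/

section DiffeomorphismCurves

open Filter Asymptotics

variable {E : Type*} [NormedAddCommGroup E] [NormedSpace ℝ E]
  {H : Type*} [TopologicalSpace H] {J : ModelWithCorners ℝ E H}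
  {N : Type*} [TopologicalSpace N] [ChartedSpace H N]

@[simp]
theorem Diffeomorph.mul_apply_self (φ ψ : N ≃ₘ^∞⟮J, J⟯ N) (p : N) : (φ * ψ) p = φ (ψ p) := rfl

@[simp]
theorem Diffeomorph.one_apply_self (p : N) : (1 : N ≃ₘ^∞⟮J, J⟯ N) p = p := rfl

@[simp]
theorem Diffeomorph.apply_inv_self_apply (φ : N ≃ₘ^∞⟮J, J⟯ N) (p : N) : φ (φ⁻¹ p) = p :=
  φ.apply_symm_apply p

@[simp]
theorem Diffeomorph.inv_apply_self_apply (φ : N ≃ₘ^∞⟮J, J⟯ N) (p : N) : φ⁻¹ (φ p) = p :=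
  φ.symm_apply_apply p

/-- `φ` is a smooth curve of diffeomorphisms, defined for `|t| < ε`, through the identity. -/
structure IsDiffeoCurve (ε : ℝ) (φ : ℝ → N ≃ₘ^∞⟮J, J⟯ N) : Prop where
  pos : 0 < ε
  contMDiffOn : ContMDiffOn (𝓘(ℝ, ℝ).prod J) J ∞ (fun q : ℝ × N => φ q.1 q.2)
    (Ioo (-ε) ε ×ˢ univ)
  map_zero : φ 0 = 1

/-- In the preferred chart at `p`, `c t = p + t ^ k w + o(t ^ k)`. -/
def HasLeadingTerm (J : ModelWithCorners ℝ E H) (c : ℝ → N) (p : N) (k : ℕ) (w : E) : Prop :=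
  (fun t => extChartAt J p (c t) - extChartAt J p p - t ^ k • w) =o[𝓝 0] fun t : ℝ => t ^ k

namespace IsDiffeoCurve

variable {ε ε' : ℝ} {φ ψ : ℝ → N ≃ₘ^∞⟮J, J⟯ N}

theorem zero_mem (hφ : IsDiffeoCurve ε φ) : (0 : ℝ) ∈ Ioo (-ε) ε :=
  ⟨neg_lt_zero.2 hφ.pos, hφ.pos⟩

theorem apply_zero (hφ : IsDiffeoCurve ε φ) (p : N) : φ 0 p = p := by
  rw [hφ.map_zero, Diffeomorph.one_apply_self]

theorem contMDiffAt (hφ : IsDiffeoCurve ε φ) {t : ℝ} (ht : t ∈ Ioo (-ε) ε) (p : N) :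
    ContMDiffAt (𝓘(ℝ, ℝ).prod J) J ∞ (fun q : ℝ × N => φ q.1 q.2) (t, p) :=
  hφ.contMDiffOn.contMDiffAt (prod_mem_nhds (isOpen_Ioo.mem_nhds ht) univ_mem)

theorem contMDiffAt_apply (hφ : IsDiffeoCurve ε φ) (p : N) :
    ContMDiffAt 𝓘(ℝ, ℝ) J ∞ (fun t => φ t p) 0 :=
  ContMDiffAt.comp (g := fun q : ℝ × N => φ q.1 q.2) (f := fun t => (t, p)) 0
    (hφ.contMDiffAt hφ.zero_mem p) (contMDiffAt_id.prodMk contMDiffAt_const)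

theorem tendsto_apply (hφ : IsDiffeoCurve ε φ) (p : N) :
    Tendsto (fun t => φ t p) (𝓝 0) (𝓝 p) := by
  simpa [hφ.apply_zero p] using (hφ.contMDiffAt_apply p).continuousAt.tendsto

theorem one : IsDiffeoCurve (J := J) (N := N) 1 (fun _ => 1) :=
  ⟨one_pos, contMDiffOn_snd, rfl⟩

theorem mul (hφ : IsDiffeoCurve ε φ) (hψ : IsDiffeoCurve ε' ψ) :
    IsDiffeoCurve (min ε ε') fun t => φ t * ψ t := by
  refine ⟨lt_min hφ.pos hψ.pos, fun q hq => ContMDiffAt.contMDiffWithinAt ?_, ?_⟩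
  · obtain ⟨t, p⟩ := q
    have h1 : t ∈ Ioo (-ε) ε :=
      ⟨by linarith [hq.1.1, min_le_left ε ε'], hq.1.2.trans_le (min_le_left _ _)⟩
    have h2 : t ∈ Ioo (-ε') ε' :=
      ⟨by linarith [hq.1.1, min_le_right ε ε'], hq.1.2.trans_le (min_le_right _ _)⟩
    exact ContMDiffAt.comp (g := fun q : ℝ × N => φ q.1 q.2)
      (f := fun q : ℝ × N => (q.1, ψ q.1 q.2)) (t, p) (hφ.contMDiffAt h1 _)
      (contMDiffAt_fst.prodMk (hψ.contMDiffAt h2 p))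
  · rw [hφ.map_zero, hψ.map_zero, one_mul]

theorem exists_reparametrization (hφ : IsDiffeoCurve ε φ) (a : ℝ) {l : ℕ} (hl : 1 ≤ l) :
    ∃ δ, (∀ t ∈ Ioo (-δ) δ, a * t ^ l ∈ Ioo (-ε) ε) ∧
      IsDiffeoCurve δ fun t => φ (a * t ^ l) := by
  have hc : Continuous fun t : ℝ => a * t ^ l := by fun_prop
  have h0 : a * (0 : ℝ) ^ l = 0 := by rw [zero_pow (by omega), mul_zero]
  have h1 : ∀ᶠ t : ℝ in 𝓝 0, a * t ^ l ∈ Ioo (-ε) ε :=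
    (hc.tendsto' 0 0 h0).eventually (isOpen_Ioo.mem_nhds hφ.zero_mem)
  obtain ⟨δ, hδ, h2⟩ := Metric.eventually_nhds_iff_ball.1 h1
  have h3 : ∀ t ∈ Ioo (-δ) δ, a * t ^ l ∈ Ioo (-ε) ε := fun t ht =>
    h2 t (by rwa [Real.ball_eq_Ioo, zero_sub, zero_add])
  refine ⟨δ, h3, hδ, fun q hq => ContMDiffAt.contMDiffWithinAt ?_, ?_⟩
  · obtain ⟨t, p⟩ := q
    have hs : ContMDiff 𝓘(ℝ, ℝ) 𝓘(ℝ, ℝ) ∞ fun t : ℝ => a * t ^ l := by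
      refine ContDiff.contMDiff ?_
      fun_prop
    exact ContMDiffAt.comp (g := fun q : ℝ × N => φ q.1 q.2)
      (f := fun q : ℝ × N => (a * q.1 ^ l, q.2)) (t, p) (hφ.contMDiffAt (h3 t hq.1) _)
      ((hs.contMDiffAt.comp (t, p) contMDiffAt_fst).prodMk contMDiffAt_snd)
  · rw [h0, hφ.map_zero]

variable [IsManifold J ∞ N] [J.Boundaryless]

theorem contDiffAt_chart (hφ : IsDiffeoCurve ε φ) {t : ℝ} (ht : t ∈ Ioo (-ε) ε) {p q : N} {x : E}
    (hx : x ∈ (extChartAt J q).target)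
    (hp : φ t ((extChartAt J q).symm x) ∈ (extChartAt J p).source) :
    ContDiffAt ℝ ∞ (fun z : ℝ × E => extChartAt J p (φ z.1 ((extChartAt J q).symm z.2)))
      (t, x) := by
  have h1 : ContMDiffAt (𝓘(ℝ, ℝ).prod 𝓘(ℝ, E)) J ∞
      (fun z : ℝ × E => (extChartAt J q).symm z.2) (t, x) :=
    ((contMDiffOn_extChartAt_symm q).contMDiffAt
      ((isOpen_extChartAt_target q).mem_nhds hx)).comp (t, x) contMDiffAt_snd
  have h2 : ContMDiffAt (𝓘(ℝ, ℝ).prod 𝓘(ℝ, E)) J ∞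
      (fun z : ℝ × E => φ z.1 ((extChartAt J q).symm z.2)) (t, x) :=
    ContMDiffAt.comp (g := fun q : ℝ × N => φ q.1 q.2)
      (f := fun z : ℝ × E => (z.1, (extChartAt J q).symm z.2)) (t, x) (hφ.contMDiffAt ht _)
      (contMDiffAt_fst.prodMk h1)
  have h3 := (contMDiffAt_extChartAt' (I := J) (n := ∞)
    (by rwa [extChartAt_source] at hp)).comp (t, x) h2
  rw [← modelWithCornersSelf_prod, chartedSpaceSelf_prod] at h3
  exact h3.contDiffAt

/-- The inverses of a smooth curve of diffeomorphisms form a smooth curve. -/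
theorem inv [CompleteSpace E] (hφ : IsDiffeoCurve ε φ) : IsDiffeoCurve ε fun t => (φ t)⁻¹ := by
  refine ⟨hφ.pos, fun w hw => ContMDiffAt.contMDiffWithinAt ?_, by rw [hφ.map_zero, inv_one]⟩
  obtain ⟨t₀, p⟩ := w
  have ht₀ : t₀ ∈ Ioo (-ε) ε := hw.1
  set q : N := (φ t₀)⁻¹ p with hq
  have hqp : φ t₀ q = p := by simp [hq]
  set x₀ := extChartAt J q q with hx₀
  have hxt : x₀ ∈ (extChartAt J q).target := mem_extChartAt_target q
  have hxq : (extChartAt J q).symm x₀ = q := extChartAt_to_inv q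
  set f : ℝ × E → E := fun z => extChartAt J p (φ z.1 ((extChartAt J q).symm z.2)) with hf
  have hfs : ContDiffAt ℝ ∞ f (t₀, x₀) := by
    refine hφ.contDiffAt_chart ht₀ hxt ?_
    rw [hxq, hqp]
    exact mem_extChartAt_source p
  have hfd := hfs.differentiableAt (by simp)
  -- the partial derivative in the second variable is the differential of `φ t₀`
  have hL : fderiv ℝ (fun x => f (t₀, x)) x₀ = mfderiv J J (φ t₀) q := by
    have hmd : MDifferentiableAt J J (φ t₀) q := (φ t₀).contMDiff.mdifferentiableAt (by simp)
    have h1 : fderivWithin ℝ (writtenInExtChartAt J J q (φ t₀)) (range J) x₀ =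
        mfderiv J J (φ t₀) q := hmd.mfderiv.symm
    rw [← h1, ModelWithCorners.range_eq_univ, fderivWithin_univ]
    simp only [writtenInExtChartAt, hqp]
    rfl
  set L : E ≃L[ℝ] E := (φ t₀).mfderivToContinuousLinearEquiv (by simp) q with hLdef
  have hL' : (L : E →L[ℝ] E) = fderiv ℝ (fun x => f (t₀, x)) x₀ := by
    rw [hL]; rfl
  have hL2 : fderiv ℝ (fun x => f (t₀, x)) x₀ =
      (fderiv ℝ f (t₀, x₀)).comp (ContinuousLinearMap.inr ℝ ℝ E) :=
    (hfd.hasFDerivAt.comp x₀ (hasFDerivAt_prodMk_right t₀ x₀)).fderiv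
  -- The inverse function theorem is applied to (t, x) ↦ (t, f(t, x)). Its differential is block
  -- triangular with diagonal blocks the identity and L, hence invertible because φ t₀ is a
  -- diffeomorphism.
  let A : (ℝ × E) ≃L[ℝ] (ℝ × E) := (ContinuousLinearEquiv.refl ℝ ℝ).skewProd L
    ((fderiv ℝ f (t₀, x₀)).comp (ContinuousLinearMap.inl ℝ ℝ E))
  have hA : (A : (ℝ × E) →L[ℝ] (ℝ × E)) =
      (ContinuousLinearMap.fst ℝ ℝ E).prod (fderiv ℝ f (t₀, x₀)) := by
    refine ContinuousLinearMap.ext fun z => ?_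
    obtain ⟨s, v⟩ := z
    refine Prod.ext rfl ?_
    have h1 : L v = fderiv ℝ f (t₀, x₀) (0, v) := by
      have := congrArg (fun T : E →L[ℝ] E => T v) (hL'.trans hL2)
      simpa using this
    change L v + fderiv ℝ f (t₀, x₀) (s, 0) = fderiv ℝ f (t₀, x₀) (s, v)
    rw [h1, ← map_add]
    simp
  have hG : ContDiffAt ℝ ∞ (fun z : ℝ × E => (z.1, f z)) (t₀, x₀) := contDiffAt_fst.prodMk hfs
  have hG' : HasFDerivAt (fun z : ℝ × E => (z.1, f z)) (A : (ℝ × E) →L[ℝ] (ℝ × E)) (t₀, x₀) := by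
    rw [hA]
    exact hasFDerivAt_fst.prodMk hfd.hasFDerivAt
  set g := hG.localInverse hG' (by simp) with hg
  have hgs : ContDiffAt ℝ ∞ g (t₀, f (t₀, x₀)) := hG.to_localInverse hG' (by simp)
  have hg0 : g (t₀, f (t₀, x₀)) = (t₀, x₀) := hG.localInverse_apply_image hG' (by simp)
  have hf0 : f (t₀, x₀) = extChartAt J p p := by simp only [hf, hxq, hqp]
  rw [hf0] at hgs hg0
  have hgr : ∀ᶠ z in 𝓝 (t₀, extChartAt J p p), ((g z).1, f (g z)) = z := by
    have := (hG.hasStrictFDerivAt' hG' (by simp)).eventually_right_inverse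
    rw [hf0] at this
    exact this
  -- the local inverse in terms of the manifold
  have hc : ContMDiffAt (𝓘(ℝ, ℝ).prod J) 𝓘(ℝ, ℝ × E) ∞
      (fun w : ℝ × N => (w.1, extChartAt J p w.2)) (t₀, p) := by
    rw [modelWithCornersSelf_prod, ← chartedSpaceSelf_prod]
    exact contMDiffAt_fst.prodMk (contMDiffAt_extChartAt.comp (t₀, p) contMDiffAt_snd)
  have hgc : ContMDiffAt (𝓘(ℝ, ℝ).prod J) 𝓘(ℝ, E) ∞
      (fun w : ℝ × N => (g (w.1, extChartAt J p w.2)).2) (t₀, p) :=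
    ContMDiffAt.comp (I' := 𝓘(ℝ, ℝ × E)) (g := fun z => (g z).2)
      (f := fun w : ℝ × N => (w.1, extChartAt J p w.2)) (t₀, p)
      (contDiffAt_snd.comp _ hgs).contMDiffAt hc
  have hsym : ContMDiffAt 𝓘(ℝ, E) J ∞ (extChartAt J q).symm x₀ :=
    (contMDiffOn_extChartAt_symm q).contMDiffAt ((isOpen_extChartAt_target q).mem_nhds hxt)
  have hres : ContMDiffAt (𝓘(ℝ, ℝ).prod J) J ∞
      (fun w : ℝ × N => (extChartAt J q).symm (g (w.1, extChartAt J p w.2)).2) (t₀, p) := by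
    refine ContMDiffAt.comp (g := (extChartAt J q).symm) (t₀, p) ?_ hgc
    simpa only [hg0] using hsym
  refine hres.congr_of_eventuallyEq ?_
  have hsrc : ∀ᶠ z in 𝓝 (t₀, x₀),
      φ z.1 ((extChartAt J q).symm z.2) ∈ (extChartAt J p).source := by
    have hcont : ContinuousAt (fun z : ℝ × E => φ z.1 ((extChartAt J q).symm z.2)) (t₀, x₀) := by
      refine ContinuousAt.comp (g := fun w : ℝ × N => φ w.1 w.2)
        (f := fun z : ℝ × E => (z.1, (extChartAt J q).symm z.2)) ?_
        (continuousAt_fst.prodMk (ContinuousAt.comp hsym.continuousAt continuousAt_snd))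
      exact (hφ.contMDiffAt ht₀ _).continuousAt
    refine hcont.eventually ((isOpen_extChartAt_source p).mem_nhds ?_)
    simp only [hxq, hqp]
    exact mem_extChartAt_source p
  have hgt : Tendsto g (𝓝 (t₀, extChartAt J p p)) (𝓝 (t₀, x₀)) := by
    simpa only [hg0] using hgs.continuousAt.tendsto
  have hct : Tendsto (fun w : ℝ × N => (w.1, extChartAt J p w.2)) (𝓝 (t₀, p))
      (𝓝 (t₀, extChartAt J p p)) := hc.continuousAt.tendsto
  have hps : ∀ᶠ w : ℝ × N in 𝓝 (t₀, p), w.2 ∈ (extChartAt J p).source :=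
    continuousAt_snd.eventually ((isOpen_extChartAt_source p).mem_nhds (mem_extChartAt_source p))
  -- The local inverse keeps t fixed and solves f(t, x) = r in the chart at p; injectivity of that
  -- chart on its source identifies the solution with (φ t)⁻¹ r.
  filter_upwards [hct.eventually hgr, hct.eventually (hgt.eventually hsrc), hps] with w h1 h2 h3
  obtain ⟨t, r⟩ := w
  have h4 : (g (t, extChartAt J p r)).1 = t := congrArg Prod.fst h1
  have h5 : f (g (t, extChartAt J p r)) = extChartAt J p r := congrArg Prod.snd h1
  have h6 := (extChartAt J p).injOn h2 h3 h5
  simp only [h4] at h6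
  exact (congrArg (fun s => (φ t)⁻¹ s) h6).symm.trans (Diffeomorph.inv_apply_self_apply _ _)

end IsDiffeoCurve

end DiffeomorphismCurves

/-! ### Leading terms of curves and their behaviour under change of chart. -/

section LeadingTerms

open Filter Asymptotics

variable {E : Type*} [NormedAddCommGroup E] [NormedSpace ℝ E]
  {H : Type*} [TopologicalSpace H] {J : ModelWithCorners ℝ E H}
  {N : Type*} [TopologicalSpace N] [ChartedSpace H N]

theorem isBigO_pow_smul (k : ℕ) (w : E) :
    (fun t : ℝ => t ^ k • w) =O[𝓝 0] fun t : ℝ => t ^ k :=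
  IsBigO.of_bound ‖w‖ (Eventually.of_forall fun t => by rw [norm_smul, mul_comm])

theorem HasLeadingTerm.isBigO {c : ℝ → N} {p : N} {k : ℕ} {w : E} (h : HasLeadingTerm J c p k w) :
    (fun t => extChartAt J p (c t) - extChartAt J p p) =O[𝓝 0] fun t : ℝ => t ^ k :=
  ((IsLittleO.isBigO h).add (isBigO_pow_smul k w)).congr_left fun t => by abel

theorem HasLeadingTerm.reparametrize {c : ℝ → N} {p : N} {k : ℕ} {w : E}
    (h : HasLeadingTerm J c p k w) (a : ℝ) {l : ℕ} (hl : 1 ≤ l) :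
    HasLeadingTerm J (fun t => c (a * t ^ l)) p (k * l) (a ^ k • w) := by
  have h0 : a * (0 : ℝ) ^ l = 0 := by rw [zero_pow (by omega), mul_zero]
  have hc : Tendsto (fun t : ℝ => a * t ^ l) (𝓝 0) (𝓝 0) := by
    have : Continuous fun t : ℝ => a * t ^ l := by fun_prop
    exact this.tendsto' 0 0 h0
  refine ((IsLittleO.comp_tendsto h hc).congr_left fun t => ?_).trans_isBigO
    (IsBigO.of_bound (|a| ^ k) (Eventually.of_forall fun t => ?_))
  · simp only [Function.comp_apply, smul_smul]
    congr 2
    ring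
  · simp only [Function.comp_apply, norm_pow, norm_mul, Real.norm_eq_abs]
    exact le_of_eq (by ring)

/-- Taylor's formula in one direction, `iteratedDeriv_of_isLittleO` in the other. Subtracting the
initial value makes the derivative of order 0 vanish and leaves the higher ones unchanged. -/
theorem isIntegralCurveOfOrder_iff [IsManifold J ∞ N] {c : ℝ → N} {p : N} {k : ℕ}
    {w : E} (hc : ContMDiffAt 𝓘(ℝ, ℝ) J ∞ c 0) (h0 : c 0 = p) :
    IsIntegralCurveOfOrder J N k c p w ↔
      1 ≤ k ∧ HasLeadingTerm J c p k ((k.factorial : ℝ)⁻¹ • w) := by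
  subst h0
  have hs : ContDiffAt ℝ ∞ (fun t => extChartAt J (c 0) (c t)) 0 :=
    ((contMDiffAt_extChartAt (I := J) (n := ∞)).comp 0 hc).contDiffAt
  have hs' : ContDiffAt ℝ ∞ (fun t => extChartAt J (c 0) (c t) - extChartAt J (c 0) (c 0)) 0 :=
    hs.sub contDiffAt_const
  have hd : ∀ j, 1 ≤ j →
      iteratedDeriv j (fun t => extChartAt J (c 0) (c t) - extChartAt J (c 0) (c 0)) 0 =
        iteratedDeriv j (fun t => extChartAt J (c 0) (c t)) 0 := by
    intro j hj
    obtain ⟨i, rfl⟩ : ∃ i, j = i + 1 := ⟨j - 1, by omega⟩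
    rw [iteratedDeriv_succ', iteratedDeriv_succ']
    congr 1
    funext t
    exact deriv_sub_const _
  have hf : (k.factorial : ℝ) ≠ 0 := by exact_mod_cast k.factorial_ne_zero
  constructor
  · rintro ⟨hk, -, h1, h2⟩
    refine ⟨hk, ?_⟩
    have := isLittleO_sub_monomial (k := k) hs' fun j hj => by
      rcases Nat.eq_zero_or_pos j with rfl | hj'
      · simp
      · rw [hd j hj', h1 j hj' hj]
    rw [hd k hk, h2] at this
    refine this.congr_left fun t => ?_
    rw [smul_smul, div_eq_mul_inv]
  · rintro ⟨hk, h⟩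
    obtain ⟨h1, h2⟩ := iteratedDeriv_of_isLittleO hs' h
    refine ⟨hk, rfl, fun j hj hjk => by rw [← hd j hj, h1 j hjk], ?_⟩
    rw [← hd k hk, h2, smul_smul, mul_inv_cancel₀ hf, one_smul]

/-- The differential at `q` of the preferred chart at `p`, in the preferred chart at `q`. -/
noncomputable def chartDifferential (J : ModelWithCorners ℝ E H) (p q : N) : E →L[ℝ] E :=
  mfderiv J 𝓘(ℝ, E) (extChartAt J p) q

variable [IsManifold J ∞ N]

theorem chartDifferential_self (p : N) : chartDifferential J p p = ContinuousLinearMap.id ℝ E := by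
  have : IsManifold J 1 N := IsManifold.of_le (n := ∞) (by exact_mod_cast le_top)
  exact mfderiv_extChartAt_self

/-- The coordinate expression of a vector field in the chart at `p`. -/
noncomputable abbrev chartVectorField (J : ModelWithCorners ℝ E H) (X : Π q : N, TangentSpace J q)
    (p : N) : E → E :=
  VectorField.mpullbackWithin 𝓘(ℝ, E) J (extChartAt J p).symm X (range J)

/-- The pullback by the inverse chart uses the inverse of the differential of that map, which is the
differential of the chart itself. -/
theorem chartVectorField_apply (X : Π q : N, TangentSpace J q) {p : N} {x : E}
    (hx : x ∈ (extChartAt J p).target) :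
    chartVectorField J X p x =
      chartDifferential J p ((extChartAt J p).symm x) (X ((extChartAt J p).symm x)) := by
  have : IsManifold J 1 N := IsManifold.of_le (n := ∞) (by exact_mod_cast le_top)
  exact congrArg (fun T => T (X ((extChartAt J p).symm x))) (ContinuousLinearMap.inverse_eq
    (mfderivWithin_extChartAt_symm_comp_mfderiv_extChartAt hx)
    (mfderiv_extChartAt_comp_mfderivWithin_extChartAt_symm hx))

theorem chartVectorField_self (X : Π q : N, TangentSpace J q) (p : N) :
    chartVectorField J X p (extChartAt J p p) = X p := by
  -- The point obtained by applying the chart and its inverse is p only propositionally, while X is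
  -- dependent; a general q = p allows the substitution.
  have key : ∀ q, q = p → chartDifferential J p q (X q) = X p := by
    rintro q rfl
    rw [chartDifferential_self]
    rfl
  exact (chartVectorField_apply X (mem_extChartAt_target p)).trans (key _ (extChartAt_to_inv p))

variable [J.Boundaryless]

theorem hasFDerivAt_chartDifferential {p q : N} (hq : q ∈ (extChartAt J p).source) :
    HasFDerivAt (fun x => extChartAt J p ((extChartAt J q).symm x)) (chartDifferential J p q)
      (extChartAt J q q) := by
  have : IsManifold J 1 N := IsManifold.of_le (n := ∞) (by exact_mod_cast le_top)
  have hmd : HasMFDerivAt J 𝓘(ℝ, E) (extChartAt J p) q (mfderiv J 𝓘(ℝ, E) (extChartAt J p) q) :=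
    (mdifferentiableAt_extChartAt (by rwa [extChartAt_source] at hq)).hasMFDerivAt
  have h := hmd.2
  rw [ModelWithCorners.range_eq_univ] at h
  exact hasFDerivWithinAt_univ.1 h

/-- The leading term of a curve in the chart at `p` of its first point `q`. -/
theorem HasLeadingTerm.isLittleO_extChartAt {c : ℝ → N} {p q : N} {k : ℕ} {w : E}
    (h : HasLeadingTerm J c q k w) (hc : Tendsto c (𝓝 0) (𝓝 q))
    (hq : q ∈ (extChartAt J p).source) :
    (fun t => extChartAt J p (c t) - extChartAt J p q - t ^ k • chartDifferential J p q w)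
      =o[𝓝 0] fun t : ℝ => t ^ k := by
  have hfd := hasFDerivAt_chartDifferential hq
  set L := chartDifferential J p q
  have hct : Tendsto (fun t => extChartAt J q (c t)) (𝓝 0) (𝓝 (extChartAt J q q)) :=
    (continuousAt_extChartAt q).tendsto.comp hc
  -- First-order expansion of the change of charts along c: its error is o of an O(t^k) increment.
  have h1 := (hfd.isLittleO.comp_tendsto hct).trans_isBigO h.isBigO
  have h2 := (L.isBigO_comp _ _).trans_isLittleO h
  refine (h1.add h2).congr' ?_ EventuallyEq.rfl
  filter_upwards [hc.eventually (extChartAt_source_mem_nhds (I := J) q)] with t ht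
  simp only [Function.comp_apply, (extChartAt J q).left_inv ht, extChartAt_to_inv, map_sub,
    map_smul]
  abel

/-- The manifold bracket is the bracket in the chart, pulled back by the chart; at p the
differential of the preferred chart is the identity, so this last pullback does nothing. -/
theorem mlieBracket_eq_lieBracket_chartVectorField (X Y : Π q : N, TangentSpace J q) (p : N) :
    VectorField.mlieBracket J X Y p = VectorField.lieBracket ℝ (chartVectorField J X p)
      (chartVectorField J Y p) (extChartAt J p p) := by
  have : IsManifold J 1 N := IsManifold.of_le (n := ∞) (by exact_mod_cast le_top)
  have h : (mfderiv J 𝓘(ℝ, E) (extChartAt J p) p).inverse = ContinuousLinearMap.id ℝ E := by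
    rw [mfderiv_extChartAt_self]
    exact ContinuousLinearMap.inverse_id
  rw [← VectorField.mlieBracketWithin_univ, VectorField.mlieBracketWithin_apply]
  refine (congrArg (fun T : E →L[ℝ] E => T _) h).trans ?_
  simp only [chartVectorField, ModelWithCorners.range_eq_univ, preimage_univ, univ_inter]
  exact congrFun VectorField.lieBracketWithin_univ _

end LeadingTerms

/-! ### Leading terms of products, inverses and commutators. -/

section Composition

open Filter Asymptotics

variable {E : Type*} [NormedAddCommGroup E] [NormedSpace ℝ E]
  {H : Type*} [TopologicalSpace H] {J : ModelWithCorners ℝ E H}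
  {N : Type*} [TopologicalSpace N] [ChartedSpace H N]

/-- The local expression of a curve of diffeomorphisms in the chart at `p`. -/
noncomputable def chartFlow (φ : ℝ → N ≃ₘ^∞⟮J, J⟯ N) (p : N) (z : ℝ × E) : E :=
  extChartAt J p (φ z.1 ((extChartAt J p).symm z.2))

theorem chartFlow_apply_extChartAt (φ : ℝ → N ≃ₘ^∞⟮J, J⟯ N) {p q : N}
    (hq : q ∈ (extChartAt J p).source) (t : ℝ) :
    chartFlow φ p (t, extChartAt J p q) = extChartAt J p (φ t q) := by
  rw [chartFlow, (extChartAt J p).left_inv hq]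

theorem chartFlow_self (φ : ℝ → N ≃ₘ^∞⟮J, J⟯ N) (p : N) (t : ℝ) :
    chartFlow φ p (t, extChartAt J p p) = extChartAt J p (φ t p) :=
  chartFlow_apply_extChartAt φ (mem_extChartAt_source p) t

theorem tendsto_extChartAt {a : ℝ → N} {p : N} (ha : Tendsto a (𝓝 0) (𝓝 p)) :
    Tendsto (fun t => extChartAt J p (a t)) (𝓝 0) (𝓝 (extChartAt J p p)) :=
  (continuousAt_extChartAt p).tendsto.comp ha

namespace IsDiffeoCurve

variable {ε ε' : ℝ} {φ ψ : ℝ → N ≃ₘ^∞⟮J, J⟯ N}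

theorem chartFlow_zero (hφ : IsDiffeoCurve ε φ) {p : N} {x : E}
    (hx : x ∈ (extChartAt J p).target) : chartFlow φ p (0, x) = x := by
  rw [chartFlow, hφ.apply_zero, (extChartAt J p).right_inv hx]

variable [IsManifold J ∞ N] [J.Boundaryless]

theorem contDiffAt_chartFlow (hφ : IsDiffeoCurve ε φ) {p : N} {x : E}
    (hx : x ∈ (extChartAt J p).target) : ContDiffAt ℝ ∞ (chartFlow φ p) (0, x) := by
  refine hφ.contDiffAt_chart hφ.zero_mem hx ?_
  rw [hφ.apply_zero]
  exact (extChartAt J p).map_target hx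

/-- The displacement `φ t y - y` in the chart at `p` is smooth. -/
theorem contDiffAt_displacement (hφ : IsDiffeoCurve ε φ) {p : N} {x : E}
    (hx : x ∈ (extChartAt J p).target) :
    ContDiffAt ℝ ∞ (fun z : ℝ × E => chartFlow φ p z - z.2) (0, x) :=
  (hφ.contDiffAt_chartFlow hx).sub contDiffAt_snd

/-- At t = 0 the displacement is identically zero, so its differential in the space variable
vanishes there. Hence, for small t, φ_t moves nearby points almost by a common translation. -/
theorem isLittleO_displacement_sub (hφ : IsDiffeoCurve ε φ) {p : N} {y : ℝ → E}
    (hy : Tendsto y (𝓝 0) (𝓝 (extChartAt J p p))) :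
    (fun t => chartFlow φ p (t, y t) - chartFlow φ p (t, extChartAt J p p) -
      (y t - extChartAt J p p)) =o[𝓝 0] fun t => y t - extChartAt J p p := by
  have h := isLittleO_increment (k := 0)
    (hφ.contDiffAt_displacement (mem_extChartAt_target (I := J) p)) (by simp)
  have hd : fderiv ℝ (fun y => iteratedDeriv 0 (fun t => chartFlow φ p (t, y) - y) 0)
      (extChartAt J p p) = 0 := by
    have : (fun y => iteratedDeriv 0 (fun t => chartFlow φ p (t, y) - y) 0)
        =ᶠ[𝓝 (extChartAt J p p)] fun _ => 0 := by
      filter_upwards [extChartAt_target_mem_nhds (I := J) p] with x hx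
      rw [iteratedDeriv_zero, hφ.chartFlow_zero hx, sub_self]
    rw [this.fderiv_eq]
    simp
  rw [hd] at h
  refine ((h.comp_tendsto (tendsto_id.prodMk_nhds hy)).congr_left fun t => ?_).congr_right
    fun t => ?_
  · simp only [Function.comp_apply, zero_apply, smul_zero, id]
    abel
  · simp

/-- Applying a curve of diffeomorphisms through the identity does not change leading terms: the
leading term of `a` is read off from that of `φ t (a t)` relative to `φ t p`. -/
theorem hasLeadingTerm_of_apply (hφ : IsDiffeoCurve ε φ) {a : ℝ → N} {p : N} {k : ℕ} {w : E}
    (ha : Tendsto a (𝓝 0) (𝓝 p))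
    (h : (fun t => extChartAt J p (φ t (a t)) - extChartAt J p (φ t p) - t ^ k • w) =o[𝓝 0]
      fun t : ℝ => t ^ k) : HasLeadingTerm J a p k w := by
  have h1 := hφ.isLittleO_displacement_sub (tendsto_extChartAt (J := J) ha)
  have h2 : (fun t => extChartAt J p (φ t (a t)) - extChartAt J p (φ t p) -
      (extChartAt J p (a t) - extChartAt J p p)) =o[𝓝 0]
      fun t => extChartAt J p (a t) - extChartAt J p p := by
    refine h1.congr' ?_ EventuallyEq.rfl
    filter_upwards [ha.eventually (extChartAt_source_mem_nhds (I := J) p)] with t ht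
    rw [chartFlow_apply_extChartAt φ ht, chartFlow_self]
  have h3 : (fun t => extChartAt J p (φ t (a t)) - extChartAt J p (φ t p)) =O[𝓝 0]
      fun t : ℝ => t ^ k :=
    (h.isBigO.add (isBigO_pow_smul k w)).congr_left fun t => by abel
  -- The error in `h2` is measured by the unknown increment of a. Since u - v = o(v) implies v =
  -- O(u), that increment is bounded by the known one and is therefore O(t^k).
  have h4 : (fun t => extChartAt J p (a t) - extChartAt J p p) =O[𝓝 0]
      fun t => extChartAt J p (φ t (a t)) - extChartAt J p (φ t p) :=
    h2.right_isBigO_add.congr_right fun t => by abel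
  have h5 := h2.trans_isBigO (h4.trans h3)
  exact (h.sub h5).congr_left fun t => by abel

/-- Up to o(t^k), φ_t displaces ψ_t p as it displaces p, so the two displacements add. -/
theorem hasLeadingTerm_mul (hφ : IsDiffeoCurve ε φ) (hψ : IsDiffeoCurve ε' ψ) {p : N} {k : ℕ}
    {v w : E} (hv : HasLeadingTerm J (fun t => φ t p) p k v)
    (hw : HasLeadingTerm J (fun t => ψ t p) p k w) :
    HasLeadingTerm J (fun t => (φ t * ψ t) p) p k (v + w) := by
  have h1 := (hφ.isLittleO_displacement_sub
    (tendsto_extChartAt (J := J) (hψ.tendsto_apply p))).trans_isBigO hw.isBigO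
  refine ((h1.add hv).add hw).congr' ?_ EventuallyEq.rfl
  filter_upwards [(hψ.tendsto_apply p).eventually (extChartAt_source_mem_nhds (I := J) p)] with t ht
  rw [chartFlow_apply_extChartAt φ ht, chartFlow_self, Diffeomorph.mul_apply_self, smul_add]
  abel

/-- Applying φ_t to (φ_t)⁻¹ p gives p, and p - φ_t p has leading coefficient -v; no expansion of the
inverse is needed. -/
theorem hasLeadingTerm_inv [CompleteSpace E] (hφ : IsDiffeoCurve ε φ) {p : N} {k : ℕ} {v : E}
    (hv : HasLeadingTerm J (fun t => φ t p) p k v) :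
    HasLeadingTerm J (fun t => (φ t)⁻¹ p) p k (-v) := by
  refine hφ.hasLeadingTerm_of_apply (hφ.inv.tendsto_apply p) ?_
  refine (IsLittleO.neg_left hv).congr_left fun t => ?_
  rw [Diffeomorph.apply_inv_self_apply, smul_neg]
  abel

/-- In the chart at `p` the derivatives at `t = 0` of the displacement are read off from the leading
terms at all points of the chart domain. -/
theorem iteratedDeriv_displacement (hφ : IsDiffeoCurve ε φ) {X : Π q : N, TangentSpace J q} {k : ℕ}
    (hX : ∀ q, HasLeadingTerm J (fun t => φ t q) q k (X q)) {p : N} {x : E}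
    (hx : x ∈ (extChartAt J p).target) :
    (∀ j < k, iteratedDeriv j (fun t => chartFlow φ p (t, x) - x) 0 = 0) ∧
      iteratedDeriv k (fun t => chartFlow φ p (t, x) - x) 0 =
        (k.factorial : ℝ) • chartVectorField J X p x := by
  have hq := (extChartAt J p).map_target hx
  -- The hypothesis at the moving point is expressed in that point's own preferred chart; passing to
  -- the fixed chart at p turns X into its coordinate expression.
  have h := (hX ((extChartAt J p).symm x)).isLittleO_extChartAt (hφ.tendsto_apply _) hq
  rw [(extChartAt J p).right_inv hx] at h
  have hs : ContDiffAt ℝ ∞ (fun t => chartFlow φ p (t, x) - x) 0 :=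
    (hφ.contDiffAt_displacement hx).comp (f := fun t : ℝ => (t, x)) 0
      (contDiffAt_id.prodMk contDiffAt_const)
  rw [chartVectorField_apply X hx]
  exact iteratedDeriv_of_isLittleO hs h

/-- The increment of the displacement along a second curve. -/
theorem isLittleO_chartFlow_sub (hφ : IsDiffeoCurve ε φ) {X : Π q : N, TangentSpace J q} {k : ℕ}
    (hX : ∀ q, HasLeadingTerm J (fun t => φ t q) q k (X q)) {p : N} {c : ℝ → N} {l : ℕ} {w : E}
    (hc : Tendsto c (𝓝 0) (𝓝 p)) (hw : HasLeadingTerm J c p l w) :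
    (fun t => extChartAt J p (φ t (c t)) - extChartAt J p (φ t p) -
      (extChartAt J p (c t) - extChartAt J p p) -
      t ^ (k + l) • fderiv ℝ (chartVectorField J X p) (extChartAt J p p) w) =o[𝓝 0]
      fun t : ℝ => t ^ (k + l) := by
  have hmem := extChartAt_target_mem_nhds (I := J) p
  have h := isLittleO_increment (k := k)
    (hφ.contDiffAt_displacement (mem_extChartAt_target (I := J) p)) fun j hj => by
      filter_upwards [hmem] with x hx using (hφ.iteratedDeriv_displacement hX hx).1 j hj
  have hD : fderiv ℝ (fun y => iteratedDeriv k (fun t => chartFlow φ p (t, y) - y) 0)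
      (extChartAt J p p) =
      (k.factorial : ℝ) • fderiv ℝ (chartVectorField J X p) (extChartAt J p p) := by
    have : (fun y => iteratedDeriv k (fun t => chartFlow φ p (t, y) - y) 0)
        =ᶠ[𝓝 (extChartAt J p p)] (k.factorial : ℝ) • chartVectorField J X p := by
      filter_upwards [hmem] with x hx using (hφ.iteratedDeriv_displacement hX hx).2
    rw [this.fderiv_eq, fderiv_const_smul_field]
    rfl
  simp only [hD] at h
  set D := fderiv ℝ (chartVectorField J X p) (extChartAt J p p)
  have hf : (k.factorial : ℝ) ≠ 0 := by exact_mod_cast k.factorial_ne_zero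
  have h1 := h.comp_tendsto (tendsto_id.prodMk_nhds (tendsto_extChartAt (J := J) hc))
  have h2 : (fun t : ℝ => t ^ k • (extChartAt J p (c t) - extChartAt J p p)) =O[𝓝 0]
      fun t : ℝ => t ^ (k + l) := by
    refine ((isBigO_refl (fun t : ℝ => t ^ k) _).smul hw.isBigO).congr_right fun t => ?_
    rw [smul_eq_mul, pow_add]
  -- The increment of c is replaced by t^l w under D; the factor t^k makes the error o(t^(k+l)).
  have h3 : (fun t : ℝ => t ^ k • D (extChartAt J p (c t) - extChartAt J p p - t ^ l • w)) =o[𝓝 0]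
      fun t : ℝ => t ^ (k + l) := by
    refine ((isBigO_refl (fun t : ℝ => t ^ k) _).smul_isLittleO
      ((D.isBigO_comp _ _).trans_isLittleO hw)).congr_right fun t => ?_
    rw [smul_eq_mul, pow_add]
  refine ((h1.trans_isBigO h2).add h3).congr' ?_ EventuallyEq.rfl
  filter_upwards [hc.eventually (extChartAt_source_mem_nhds (I := J) p)] with t ht
  simp only [Function.comp_apply, id, chartFlow_apply_extChartAt φ ht, chartFlow_self,
    smul_apply, smul_smul, div_mul_cancel₀ _ hf]
  rw [map_sub D _ (t ^ l • w), map_smul, smul_sub, smul_smul, pow_add]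
  abel

/-- After applying ψ_t φ_t, the claim compares φ_t ψ_t p with ψ_t φ_t p. Both second differences
subtract φ_t p + ψ_t p - p, so these terms cancel and DX·Y - DY·X remains. This is the bracket with
Y first, in the convention [V, W] = DW·V - DV·W. -/
theorem hasLeadingTerm_commutator [CompleteSpace E] (hφ : IsDiffeoCurve ε φ)
    (hψ : IsDiffeoCurve ε' ψ) {X Y : Π q : N, TangentSpace J q} {k l : ℕ}
    (hX : ∀ q, HasLeadingTerm J (fun t => φ t q) q k (X q))
    (hY : ∀ q, HasLeadingTerm J (fun t => ψ t q) q l (Y q)) (p : N) :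
    HasLeadingTerm J (fun t => ((ψ t * φ t)⁻¹ * (φ t * ψ t)) p) p (k + l)
      (VectorField.mlieBracket J Y X p) := by
  suffices key : ∀ v w : E, HasLeadingTerm J (fun t => φ t p) p k v →
      HasLeadingTerm J (fun t => ψ t p) p l w →
      HasLeadingTerm J (fun t => ((ψ t * φ t)⁻¹ * (φ t * ψ t)) p) p (k + l)
        (fderiv ℝ (chartVectorField J X p) (extChartAt J p p) w -
          fderiv ℝ (chartVectorField J Y p) (extChartAt J p p) v) by
    rw [mlieBracket_eq_lieBracket_chartVectorField, VectorField.lieBracket,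
      chartVectorField_self, chartVectorField_self]
    exact key _ _ (hX p) (hY p)
  intro v w hv hw
  -- The commutator is (ψφ)⁻¹(φψ), so applying ρ = ψφ to it leaves φψ.
  have hρ := hψ.mul hφ
  refine hρ.hasLeadingTerm_of_apply ((hρ.inv.mul (hφ.mul hψ)).tendsto_apply p) ?_
  have h1 := hφ.isLittleO_chartFlow_sub hX (hψ.tendsto_apply p) hw
  have h2 := hψ.isLittleO_chartFlow_sub hY (hφ.tendsto_apply p) hv
  rw [add_comm l k] at h2
  refine (h1.sub h2).congr_left fun t => ?_
  rw [Diffeomorph.mul_apply_self (ψ t * φ t)⁻¹, Diffeomorph.apply_inv_self_apply, smul_sub]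
  simp only [Diffeomorph.mul_apply_self]
  abel

end IsDiffeoCurve

end Composition

/-! ### The Lie algebra of fields tangent to a subgroup. -/

section TangentAlgebra

open Filter Asymptotics

variable {E : Type*} [NormedAddCommGroup E] [NormedSpace ℝ E]
  {H : Type*} [TopologicalSpace H] {J : ModelWithCorners ℝ E H}
  {N : Type*} [TopologicalSpace N] [ChartedSpace H N]
  {G : Subgroup (N ≃ₘ^∞⟮J, J⟯ N)}

/-- A vector field is a leading term of order `k` of a curve in `G`. -/
def IsLeadingField (G : Subgroup (N ≃ₘ^∞⟮J, J⟯ N)) (k : ℕ) (X : N → E) : Prop :=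
  ∃ (ε : ℝ) (φ : ℝ → N ≃ₘ^∞⟮J, J⟯ N), IsDiffeoCurve ε φ ∧ (∀ t ∈ Ioo (-ε) ε, φ t ∈ G) ∧
    ∀ p, HasLeadingTerm J (fun t => φ t p) p k (X p)

namespace IsLeadingField

variable {k l : ℕ} {X Y : N → E}

theorem reparametrize (h : IsLeadingField G k X) (a : ℝ) (hl : 1 ≤ l) :
    IsLeadingField G (k * l) (a ^ k • X) := by
  obtain ⟨ε, φ, hφ, hG, h⟩ := h
  obtain ⟨δ, hδ, hφ'⟩ := hφ.exists_reparametrization a hl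
  exact ⟨δ, _, hφ', fun t ht => hG _ (hδ t ht), fun p => (h p).reparametrize a hl⟩

/-- The substitution t ↦ c^(1/k) t multiplies t^k by c. -/
theorem smul_of_pos (h : IsLeadingField G k X) (hk : 1 ≤ k) {c : ℝ} (hc : 0 < c) :
    IsLeadingField G k (c • X) := by
  have h1 := h.reparametrize (c ^ ((k : ℝ)⁻¹)) le_rfl
  rwa [mul_one, Real.rpow_inv_natCast_pow hc.le (by omega)] at h1

theorem of_inv_smul (hk : 1 ≤ k) {c : ℝ} (hc : 0 < c)
    (h : IsLeadingField G k fun p => c⁻¹ • X p) : IsLeadingField G k X := by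
  have h1 := h.smul_of_pos hk hc
  rwa [show (c • fun p => c⁻¹ • X p) = X from funext fun p => smul_inv_smul₀ hc.ne' (X p)] at h1

theorem mul_order (h : IsLeadingField G k X) (hl : 1 ≤ l) : IsLeadingField G (k * l) X := by
  have h1 := h.reparametrize 1 hl
  rwa [one_pow, one_smul] at h1

theorem zero : IsLeadingField G 1 (0 : N → E) :=
  ⟨1, _, IsDiffeoCurve.one, fun _ _ => G.one_mem, fun p => by
    simp [HasLeadingTerm]⟩

variable [IsManifold J ∞ N] [J.Boundaryless]

theorem add (hX : IsLeadingField G k X) (hY : IsLeadingField G k Y) :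
    IsLeadingField G k (X + Y) := by
  obtain ⟨ε, φ, hφ, hφG, hX⟩ := hX
  obtain ⟨ε', ψ, hψ, hψG, hY⟩ := hY
  refine ⟨_, _, hφ.mul hψ, fun t ht => G.mul_mem (hφG t ?_) (hψG t ?_),
    fun p => hφ.hasLeadingTerm_mul hψ (hX p) (hY p)⟩
  · exact ⟨by linarith [ht.1, min_le_left ε ε'], ht.2.trans_le (min_le_left _ _)⟩
  · exact ⟨by linarith [ht.1, min_le_right ε ε'], ht.2.trans_le (min_le_right _ _)⟩

variable [CompleteSpace E]

theorem neg (hX : IsLeadingField G k X) : IsLeadingField G k (-X) := by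
  obtain ⟨ε, φ, hφ, hφG, hX⟩ := hX
  exact ⟨_, _, hφ.inv, fun t ht => G.inv_mem (hφG t ht), fun p => hφ.hasLeadingTerm_inv (hX p)⟩

theorem exists_smul (hX : IsLeadingField G k X) (hk : 1 ≤ k) (c : ℝ) :
    ∃ m : ℕ, 1 ≤ m ∧ IsLeadingField G m (c • X) := by
  rcases lt_trichotomy c 0 with hc | rfl | hc
  · have h := (hX.smul_of_pos hk (neg_pos.2 hc)).neg
    rw [neg_smul, neg_neg] at h
    exact ⟨k, hk, h⟩
  · rw [zero_smul]
    exact ⟨1, le_rfl, zero⟩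
  · exact ⟨k, hk, hX.smul_of_pos hk hc⟩

theorem mlieBracket (hX : IsLeadingField G k X) (hY : IsLeadingField G l Y) :
    IsLeadingField G (k + l) fun p =>
      (VectorField.mlieBracket J (fun q => (X q : TangentSpace J q)) Y p : E) := by
  obtain ⟨ε, φ, hφ, hφG, hX⟩ := hX
  obtain ⟨ε', ψ, hψ, hψG, hY⟩ := hY
  have hG : ∀ t ∈ Ioo (-min ε ε') (min ε ε'), φ t ∈ G ∧ ψ t ∈ G := fun t ht =>
    ⟨hφG t ⟨by linarith [ht.1, min_le_left ε ε'], ht.2.trans_le (min_le_left _ _)⟩,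
      hψG t ⟨by linarith [ht.1, min_le_right ε ε'], ht.2.trans_le (min_le_right _ _)⟩⟩
  refine ⟨min (min ε ε') (min ε' ε), _, (hφ.mul hψ).inv.mul (hψ.mul hφ), fun t ht => ?_,
    fun p => ?_⟩
  · rw [min_comm ε' ε, min_self] at ht
    obtain ⟨h1, h2⟩ := hG t ht
    exact G.mul_mem (G.inv_mem (G.mul_mem h1 h2)) (G.mul_mem h2 h1)
  · rw [add_comm k l]
    -- The curves are exchanged because the commutator lemma yields the bracket in reversed order.
    exact hψ.hasLeadingTerm_commutator hφ hY hX p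

end IsLeadingField

variable [IsManifold J ∞ N]

theorem isTangentTo_iff {X : SmoothVectorField J N} :
    IsTangentTo G X ↔ ∃ k : ℕ, 1 ≤ k ∧
      IsLeadingField G k fun p => ((k.factorial : ℝ)⁻¹ • (X p : E)) := by
  constructor
  · rintro ⟨ε, φ, hε, hG, hs, h0, k, hk⟩
    have hφ : IsDiffeoCurve ε φ := ⟨hε, hs, h0⟩
    -- The bound 1 ≤ k is part of the condition at each point; on an empty manifold it carries no
    -- information, and the order 1 serves.
    rcases isEmpty_or_nonempty N with hN | ⟨⟨p₀⟩⟩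
    · exact ⟨1, le_rfl, ε, φ, hφ, hG, fun p => hN.elim p⟩
    · refine ⟨k, (hk p₀).1, ε, φ, hφ, hG, fun p => ?_⟩
      exact ((isIntegralCurveOfOrder_iff (hφ.contMDiffAt_apply p) (hφ.apply_zero p)).1 (hk p)).2
  · rintro ⟨k, hk, ε, φ, hφ, hG, h⟩
    refine ⟨ε, φ, hφ.pos, hG, hφ.contMDiffOn, hφ.map_zero, k, fun p => ?_⟩
    exact (isIntegralCurveOfOrder_iff (hφ.contMDiffAt_apply p) (hφ.apply_zero p)).2 ⟨hk, h p⟩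

theorem isTangentTo_iff_isLeadingField {X : SmoothVectorField J N} :
    IsTangentTo G X ↔ ∃ k : ℕ, 1 ≤ k ∧ IsLeadingField G k fun p => (X p : E) := by
  rw [isTangentTo_iff]
  refine exists_congr fun k => and_congr_right fun hk => ?_
  have hf : (0 : ℝ) < k.factorial := by exact_mod_cast k.factorial_pos
  exact ⟨fun h => h.of_inv_smul hk hf, fun h => h.smul_of_pos hk (inv_pos.2 hf)⟩

variable [J.Boundaryless] [CompleteSpace E]

/-- The vector fields tangent to a group of diffeomorphisms form a Lie algebra. -/
noncomputable def tangentLieSubalgebra (G : Subgroup (N ≃ₘ^∞⟮J, J⟯ N)) :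
    LieSubalgebra ℝ (SmoothVectorField J N) where
  carrier := tangentAlgebra G
  zero_mem' := isTangentTo_iff_isLeadingField.2 ⟨1, le_rfl, IsLeadingField.zero⟩
  add_mem' {X Y} hX hY := by
    obtain ⟨k, hk, hX⟩ := isTangentTo_iff_isLeadingField.1 hX
    obtain ⟨l, hl, hY⟩ := isTangentTo_iff_isLeadingField.1 hY
    -- Orders k and l are both raised to kl, so that the product of the two curves adds their
    -- coefficients.
    have h2 := hY.mul_order hk
    rw [mul_comm] at h2
    exact isTangentTo_iff_isLeadingField.2 ⟨k * l, Nat.mul_pos hk hl, (hX.mul_order hl).add h2⟩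
  smul_mem' c X hX := by
    obtain ⟨k, hk, hX⟩ := isTangentTo_iff_isLeadingField.1 hX
    exact isTangentTo_iff_isLeadingField.2 (hX.exists_smul hk c)
  lie_mem' {X Y} hX hY := by
    obtain ⟨k, hk, hX⟩ := isTangentTo_iff_isLeadingField.1 hX
    obtain ⟨l, hl, hY⟩ := isTangentTo_iff_isLeadingField.1 hY
    exact isTangentTo_iff_isLeadingField.2 ⟨k + l, by omega, hX.mlieBracket hY⟩

end TangentAlgebra

/-! ### Application to the fibered holonomy group. -/

theorem mainTheorem8 (n : ℕ) (M : Type*) [TopologicalSpace M] [T2Space M] [CompactSpace M]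
    [ChartedSpace (EuclideanSpace ℝ (Fin (n + 1))) M] [IsManifold (𝓡 (n + 1)) ∞ M]
    (F : FinslerStructure n M) :
    ∃ L : LieSubalgebra ℝ (SmoothVectorField ((𝓡 (n + 1)).prod (𝓡 n)) F.IndicatrixBundle),
      (L : Set (SmoothVectorField ((𝓡 (n + 1)).prod (𝓡 n)) F.IndicatrixBundle)) =
        F.fiberedHolonomyAlgebra :=
  ⟨tangentLieSubalgebra F.fiberedHolonomyGroup, rfl⟩
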